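/- Let $K$ be a field of characteristic zero and let $D$ be a dialgebra over $K$, i.e. a $K$-vector space with bilinear products $\dashv,\vdash$ satisfying $$x\dashv(y\dashv z)=(x\dashv y)\dashv z=x\dashv(y\vdash z),\quad (x\vdash y)\dashv z=x\vdash(y\dashv z),\quad (x\dashv y)\vdash z=x\vdash(y\vdash z)=(x\vdash y)\vdash z .$$ Let $HY^*(D,D)$ be the dialgebra cohomology, i.e. the cohomology of the complex $CY^q(D,D)=\mathrm{Hom}(K[Y_q]\otimes D^{\otimes q},D)$ with $Y_q$ the set of planar binary trees with $q$ vertices, and suppose $\dim HY^2(D,D)=n<\infty$. Write $'$ for linear duals. A deformation of $D$ with base an augmented commutative unital $K$-algebra $(A,\epsilon)$ is an $A$-dialgebra structure on $A\otimes D$ such that $\epsilon\otimes\mathrm{id}\colon A\otimes D\to D$ is a morphism of dialgebras. Let $K=C_0\xleftarrow{p_0}C_1\xleftarrow{p_1}C_2\leftarrow\cdots$, together with deformations $\eta_k$ of $D$ with base $C_k$, be any sequence obtained by the following construction. * $C_1=K\oplus HY^2(D,D)'$ with $(HY^2(D,D)')^2=0$, and $\eta_1$ is the universal infinitesimal deformation: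 for a linear map $\mu$ sending each class in $HY^2(D,D)$ to a representing cocycle, its products on $C_1\otimes D=D\oplus \mathrm{Hom}(HY^2(D,D),D)$ are $(x_1,\phi_1)*(x_2,\phi_2)=(x_1*x_2,\psi)$ with $\psi(\alpha)=\mu(\alpha)(y_*;x_1,x_2)+\phi_1(\alpha)*x_2+x_1*\phi_2(\alpha)$, where $*\in\{\dashv,\vdash\}$, $y_\dashv=[21]$ is the tree in $Y_2$ whose right subtree has a vertex, and $y_\vdash=[12]$ the one whose left subtree has a vertex. * Given $(C_k,\eta_k)$ with $k\ge1$, let $\omega_k\colon H^2_{Harr}(C_k;K)\to HY^3(D,D)$ be the linear map sending the class of an extension of $C_k$ by $K$ to the obstruction to extending $\eta_k$ to that extension. A linear choice of cocycles representing the classes in $H^2_{Harr}(C_k;K)$ defines an extension $0\to H^2_{Harr}(C_k;K)'\to\overline C_{k+1}\to C_k\to0$, and $C_{k+1}$ is the quotient of $\overline C_{k+1}$ by the image of $\omega_k'\colon HY^3(D,D)'\to H^2_{Harr}(C_k;K)'$, so that there is an extension $0\to(\ker\omega_k)'\to C_{k+1}\xrightarrow{p_k}C_k\to0$. Finally $\eta_{k+1}$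 is a deformation of $D$ with base $C_{k+1}$ whose push-out along $p_k$ is $\eta_k$. Let $C=\varprojlim C_k$. Let $K[[HY^2(D,D)']]$ be the formal power series ring over $K$ in $n$ variables and let $m$ be its maximal ideal. Then there is an ideal $I\subseteq m^2$ such that $C\cong K[[HY^2(D,D)']]/I$ as $K$-algebras. -/

import Mathlib

open scoped TensorProduct

namespace DialgebraDeformation

/-- The labels of the two products of a dialgebra: `left` stands for `⊣`, `right` for `⊢`. -/
inductive Side : Type
  | left
  | right

/-- An `R`-dialgebra structure on the `R`-module `M`: `op .left x y` is `x ⊣ y` and `op .right x y`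
is `x ⊢ y`. -/
structure Dialgebra (R : Type*) (M : Type*) [CommSemiring R] [AddCommMonoid M] [Module R M] where
  op : Side → M →ₗ[R] M →ₗ[R] M
  assoc_left : ∀ x y z, op .left x (op .left y z) = op .left (op .left x y) z
  bar_left : ∀ x y z, op .left (op .left x y) z = op .left x (op .right y z)
  assoc_mid : ∀ x y z, op .left (op .right x y) z = op .right x (op .left y z)
  bar_right : ∀ x y z, op .right (op .left x y) z = op .right x (op .right y z)
  assoc_right : ∀ x y z, op .right x (op .right y z) = op .right (op .right x y) z

/-- Delete the `i`-th leaf of a planar binary tree (leaves are numbered `0, 1, …` from left to right);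
the vertex carrying that leaf disappears. A leaf is `nil`, grafting is `node ()`. -/
def delLeaf : ℕ → BinaryTree Unit → BinaryTree Unit
  | _, .nil => .nil
  | i, .node _ l r =>
      if i < l.numLeaves then
        match l with
        | .nil => r
        | .node _ _ _ => .node () (delLeaf i l) r
      else
        match r with
        | .nil => l
        | .node _ _ _ => .node () l (delLeaf (i - l.numLeaves) r)

theorem numNodes_delLeaf (i : ℕ) (t : BinaryTree Unit) :
    (delLeaf i t).numNodes = t.numNodes - 1 := by
  induction t generalizing i with
  | nil => rfl
  | node a l r hl hr =>
    rcases l with _ | _ <;> rcases r with _ | _ <;> unfold delLeaf <;> split_ifs <;>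
      simp_all <;> omega

/-- The orientation of the `i`-th leaf: `left` if it is the left branch of its vertex (drawn like a
backslash), `right` if it is the right branch (drawn like a slash). -/
def leafSide : ℕ → BinaryTree Unit → Side
  | _, .nil => .left
  | i, .node _ l r =>
      if i < l.numLeaves then
        match l with
        | .nil => .left
        | .node _ _ _ => leafSide i l
      else
        match r with
        | .nil => .right
        | .node _ _ _ => leafSide (i - l.numLeaves) r

/-- `Y n` is the set of planar binary trees with `n` vertices. -/
def Y (n : ℕ) : Type := {t : BinaryTree Unit // t.numNodes = n}

/-- The face map `d_i : Y_{n+1} → Y_n`, which deletes the `i`-th leaf. -/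
def Y.face {n : ℕ} (i : ℕ) (y : Y (n + 1)) : Y n :=
  ⟨delLeaf i y.1, by rw [numNodes_delLeaf, y.2]; rfl⟩

/-- The label `∘_i^t` of a tree `t` with `n` vertices, `0 ≤ i ≤ n`: `∘_0` is `⊣` if `t = | ∨ t₁` and `⊢`
otherwise, `∘_n` is `⊢` if `t = t₁ ∨ |` and `⊣` otherwise, and for the inner leaves it is given by
the orientation of the leaf. -/
def treeSide (i : ℕ) (t : BinaryTree Unit) : Side :=
  if i = 0 then
    match t with
    | .node _ .nil _ => .left
    | _ => .right
  else if i = t.numNodes then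
    match t with
    | .node _ _ .nil => .right
    | _ => .left
  else leafSide i t

/-- The label `∘_i^y`. -/
def Y.side {n : ℕ} (i : ℕ) (y : Y n) : Side := treeSide i y.1

/-- The trees `[21] = | ∨ [1]` (for `⊣`) and `[12] = [1] ∨ |` (for `⊢`) of `Y_2`. -/
def Y.two : Side → Y 2
  | .left => ⟨.node () .nil (.node () .nil .nil), rfl⟩
  | .right => ⟨.node () (.node () .nil .nil) .nil, rfl⟩

universe u v
variable {K : Type u} [Field K] {D : Type v} [AddCommGroup D] [Module K D]

variable (K D) in
/-- The cochains `CY^n(D,D) = Hom(K[Y_n] ⊗ D^{⊗ n}, D)`: a multilinear map `D^n → D` for each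
tree in `Y_n`. -/
abbrev CY (n : ℕ) : Type v := Y n → MultilinearMap K (fun _ : Fin n => D) D

/-- Changing one entry of `a` changes one entry of `(a_1, …, β a_i a_{i+1}, …, a_{n+1})`. -/
theorem contractNth_update {D : Type v} (β : D → D → D) {n : ℕ} (i : Fin n) (a : Fin (n + 1) → D)
    (k : Fin (n + 1)) : ∃ (j : Fin n) (h : D → D), (h = id ∨ (∃ z, h = β z) ∨ ∃ z, h = fun x => β x z) ∧
    ∀ x, Fin.contractNth i.castSucc β (Function.update a k x) =
      Function.update (Fin.contractNth i.castSucc β a) j (h x) := by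
  have hi := i.2
  have hk := k.2
  rcases lt_trichotomy k.1 i.1 with h | h | h
  · refine ⟨⟨k, by omega⟩, id, Or.inl rfl, fun x => ?_⟩
    ext l
    simp only [Fin.contractNth, Function.update_apply, Fin.ext_iff, Fin.val_castSucc, Fin.val_succ]
    grind
  · refine ⟨⟨k, by omega⟩, fun x => β x (a i.succ), Or.inr (Or.inr ⟨_, rfl⟩), fun x => ?_⟩
    ext l
    simp only [Fin.contractNth, Function.update_apply, Fin.ext_iff, Fin.val_castSucc, Fin.val_succ]
    have : l.1 = i.1 → l = i := fun h => Fin.ext h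
    grind
  · by_cases h' : k.1 = i.1 + 1
    · refine ⟨i, β (a i.castSucc), Or.inr (Or.inl ⟨_, rfl⟩), fun x => ?_⟩
      ext l
      simp only [Fin.contractNth, Function.update_apply, Fin.ext_iff, Fin.val_castSucc, Fin.val_succ]
      have : l.1 = i.1 → l = i := fun h => Fin.ext h
      grind
    · refine ⟨⟨k - 1, by omega⟩, id, Or.inl rfl, fun x => ?_⟩
      ext l
      simp only [Fin.contractNth, Function.update_apply, Fin.ext_iff, Fin.val_castSucc, Fin.val_succ]
      grind

/-- The map `a ↦ g (a_1, …, β a_i a_{i+1}, …, a_{n+1})` (entries of `a` are indexed from `0` here). -/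
def precompOp (β : D →ₗ[K] D →ₗ[K] D) {n : ℕ} (i : Fin n)
    (g : MultilinearMap K (fun _ : Fin n => D) D) :
    MultilinearMap K (fun _ : Fin (n + 1) => D) D :=
  MultilinearMap.mk' (fun a => g (Fin.contractNth i.castSucc (fun x y => β x y) a))
    (fun a k x y => by
      obtain ⟨j, h, rfl | ⟨z, rfl⟩ | ⟨z, rfl⟩, H⟩ := contractNth_update (fun x y => β x y) i a k <;>
        simp [H])
    (fun a k c x => by
      obtain ⟨j, h, rfl | ⟨z, rfl⟩ | ⟨z, rfl⟩, H⟩ := contractNth_update (fun x y => β x y) i a k <;>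
        simp [H])

/-- The map `a ↦ β a_1 (g (a_2, …, a_{n+1}))`. -/
def faceZero (β : D →ₗ[K] D →ₗ[K] D) {n : ℕ}
    (g : MultilinearMap K (fun _ : Fin n => D) D) :
    MultilinearMap K (fun _ : Fin (n + 1) => D) D :=
  LinearMap.uncurryLeft (M := fun _ : Fin (n + 1) => D)
    { toFun := fun x => (β x).compMultilinearMap g
      map_add' := fun x y => by ext a; simp
      map_smul' := fun c x => by ext a; simp }

/-- The map `a ↦ β (g (a_1, …, a_n)) a_{n+1}`. -/
def faceLast (β : D →ₗ[K] D →ₗ[K] D) {n : ℕ}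
    (g : MultilinearMap K (fun _ : Fin n => D) D) :
    MultilinearMap K (fun _ : Fin (n + 1) => D) D :=
  MultilinearMap.uncurryRight (M := fun _ : Fin (n + 1) => D) (β.compMultilinearMap g)

theorem faceZero_apply (β : D →ₗ[K] D →ₗ[K] D) {n : ℕ}
    (g : MultilinearMap K (fun _ : Fin n => D) D) (a : Fin (n + 1) → D) :
    faceZero β g a = β (a 0) (g (fun i => a i.succ)) := rfl

theorem faceLast_apply (β : D →ₗ[K] D →ₗ[K] D) {n : ℕ}
    (g : MultilinearMap K (fun _ : Fin n => D) D) (a : Fin (n + 1) → D) :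
    faceLast β g a = β (g (fun i => a i.castSucc)) (a (Fin.last n)) := rfl

theorem precompOp_apply (β : D →ₗ[K] D →ₗ[K] D) {n : ℕ} (i : Fin n)
    (g : MultilinearMap K (fun _ : Fin n => D) D) (a : Fin (n + 1) → D) :
    precompOp β i g a = g (Fin.contractNth i.castSucc (fun x y => β x y) a) := rfl

/-- The coboundary operator `δ = ∑ (-1)^i δ^i : CY^n(D,D) → CY^{n+1}(D,D)`. -/
def delta (𝒟 : Dialgebra K D) (n : ℕ) : CY K D n →ₗ[K] CY K D (n + 1) where
  toFun f y :=
    faceZero (𝒟.op (y.side 0)) (f (y.face 0)) +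
    ∑ i : Fin n, (-1 : K) ^ (i.1 + 1) •
      precompOp (𝒟.op (y.side (i.1 + 1))) i (f (y.face (i.1 + 1))) +
    (-1 : K) ^ (n + 1) • faceLast (𝒟.op (y.side (n + 1))) (f (y.face (n + 1)))
  map_add' f g := by
    ext y a
    simp [faceZero, precompOp, faceLast, Finset.sum_add_distrib]
    abel
  map_smul' c f := by
    ext y a
    simp [faceZero, precompOp, faceLast, Finset.smul_sum, smul_smul, mul_comm]

/-- The `n`-cocycles of a dialgebra with coefficients in itself. -/
def cocycles (𝒟 : Dialgebra K D) (n : ℕ) : Submodule K (CY K D n) := LinearMap.ker (delta 𝒟 n)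
/-- The `n`-coboundaries of a dialgebra with coefficients in itself. -/
def coboundaries (𝒟 : Dialgebra K D) : (n : ℕ) → Submodule K (CY K D n)
  | 0 => ⊥
  | n + 1 => LinearMap.range (delta 𝒟 n)
/-- The dialgebra cohomology `HY^n(D,D)`. -/
abbrev HY (𝒟 : Dialgebra K D) (n : ℕ) : Type v :=
  cocycles 𝒟 n ⧸ (coboundaries 𝒟 n).submoduleOf (cocycles 𝒟 n)


section Harrison
universe w x
variable {A : Type w} [CommRing A] [Algebra K A]

/-- Harrison 2-cocycles of the commutative algebra `A` with coefficients in the vector space `M`, on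
which `A` acts through the augmentation `ε`. Harrison 2-cochains are the bilinear maps that vanish on
the shuffles `a ⊗ b - b ⊗ a`. -/
def harrisonCocycles (ε : A →ₐ[K] K) (M : Type x) [AddCommGroup M] [Module K M] :
    Submodule K (A →ₗ[K] A →ₗ[K] M) where
  carrier := {f | (∀ a b, f a b = f b a) ∧
    ∀ a b c, ε a • f b c - f (a * b) c + f a (b * c) - ε c • f a b = 0}
  add_mem' {f g} hf hg := ⟨fun a b => by simp [hf.1 a b, hg.1 a b], fun a b c => by
    have h := congrArg₂ (· + ·) (hf.2 a b c) (hg.2 a b c)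
    rw [add_zero] at h
    rw [← h]
    simp only [LinearMap.add_apply]
    module⟩
  zero_mem' := ⟨fun a b => by simp, fun a b c => by simp⟩
  smul_mem' r f hf := ⟨fun a b => by simp [hf.1 a b], fun a b c => by
    have h := congrArg (r • ·) (hf.2 a b c)
    rw [smul_zero] at h
    rw [← h]
    simp only [LinearMap.smul_apply]
    module⟩

/-- The coboundary of a 1-cochain in the Harrison complex. -/
def harrisonCoboundary (ε : A →ₐ[K] K) (M : Type x) [AddCommGroup M] [Module K M] :
    (A →ₗ[K] M) →ₗ[K] (A →ₗ[K] A →ₗ[K] M) where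
  toFun g := LinearMap.mk₂ K (fun a b => ε a • g b - g (a * b) + ε b • g a)
    (fun a a' b => by simp only [map_add, add_mul]; module)
    (fun c a b => by simp only [map_smul, smul_mul_assoc, smul_eq_mul]; module)
    (fun a b b' => by simp only [map_add, mul_add]; module)
    (fun c a b => by simp only [map_smul, mul_smul_comm, smul_eq_mul]; module)
  map_add' g h := by ext a b; simp only [LinearMap.mk₂_apply, LinearMap.add_apply]; module
  map_smul' c h := by
    ext a b; simp only [LinearMap.mk₂_apply, LinearMap.smul_apply, RingHom.id_apply]; module

instance (ε : A →ₐ[K] K) (M : Type x) [AddCommGroup M] [Module K M] : AddCommGroup (harrisonCocycles ε M) :=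
  inferInstance

/-- The Harrison cohomology `H^2_Harr(A; M)`, with `A` acting on `M` through `ε`. -/
abbrev HarrisonH2 (ε : A →ₐ[K] K) (M : Type x) [AddCommGroup M] [Module K M] : Type (max w x) :=
  harrisonCocycles ε M ⧸ ((LinearMap.range (harrisonCoboundary ε M)).submoduleOf (harrisonCocycles ε M) : Submodule K (harrisonCocycles ε M))

/-- The extension `0 → M → B → A → 0` of algebras given by a Harrison cocycle `f`: the vector space
`A × M` with `(a, m) (b, n) = (a b, a n + b m + f (a, b))`; its unit is `(1, -f (1, 1))`. -/
def Extension {ε : A →ₐ[K] K} {M : Type x} [AddCommGroup M] [Module K M] (_f : harrisonCocycles ε M) :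
  Type (max w x) := A × M

namespace Extension
variable {ε : A →ₐ[K] K} {M : Type x} [AddCommGroup M] [Module K M] (f : harrisonCocycles ε M)

instance : AddCommGroup (Extension f) := inferInstanceAs (AddCommGroup (A × M))
instance : Module K (Extension f) := inferInstanceAs (Module K (A × M))
/-- The projection `B → A`, as a linear map. -/
def fstL : Extension f →ₗ[K] A := LinearMap.fst K A M
/-- The linear projection `B → M`. -/
def sndL : Extension f →ₗ[K] M := LinearMap.snd K A M
/-- The linear splitting `q : A → B`. -/
def inlL : A →ₗ[K] Extension f := LinearMap.inl K A M
/-- The inclusion `i : M → B`. -/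
def inrL : M →ₗ[K] Extension f := LinearMap.inr K A M

instance : Mul (Extension f) where
  mul u v := (fstL f u * fstL f v, ε (fstL f u) • sndL f v + ε (fstL f v) • sndL f u +
    f.1 (fstL f u) (fstL f v))
instance : One (Extension f) where
  one := ((1 : A), -f.1 1 1)

variable {f}
@[ext] theorem ext {u v : Extension f} (h : fstL f u = fstL f v) (h' : sndL f u = sndL f v) : u = v :=
  Prod.ext h h'
@[simp] theorem fst_mul (u v : Extension f) : fstL f (u * v) = fstL f u * fstL f v := rfl
@[simp] theorem snd_mul (u v : Extension f) : sndL f (u * v) =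
  ε (fstL f u) • sndL f v + ε (fstL f v) • sndL f u + f.1 (fstL f u) (fstL f v) := rfl
@[simp] theorem fst_one : fstL f 1 = 1 := rfl
@[simp] theorem snd_one : sndL f 1 = -f.1 1 1 := rfl
@[simp] theorem fst_inl (a) : fstL f (inlL f a) = a := rfl
@[simp] theorem snd_inl (a) : sndL f (inlL f a) = 0 := rfl
@[simp] theorem fst_inr (a) : fstL f (inrL f a) = 0 := rfl
@[simp] theorem snd_inr (a) : sndL f (inrL f a) = a := rfl

theorem one_coc (f : harrisonCocycles ε M) (c : A) : f.1 1 c = ε c • f.1 1 1 := by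
  have h := f.2.2 1 1 c
  simp only [map_one, one_smul, one_mul, sub_self, zero_add] at h
  exact sub_eq_zero.mp h

variable (f)
theorem mul_comm' (u v : Extension f) : u * v = v * u := by
  ext
  · simp [mul_comm]
  · simp only [snd_mul, f.2.1 (fstL f u)]; abel
theorem one_mul' (u : Extension f) : 1 * u = u := by
  ext
  · simp
  · simp [one_coc f (fstL f u)]
theorem mul_add' (u v z : Extension f) : u * (v + z) = u * v + u * z := by
  ext
  · simp [mul_add]
  · simp only [snd_mul, map_add]; module
theorem mul_assoc' (u v z : Extension f) : u * v * z = u * (v * z) := by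
  ext
  · simp [mul_assoc]
  · have h := f.2.2 (fstL f u) (fstL f v) (fstL f z)
    rw [← sub_eq_zero, ← neg_eq_zero, ← h]
    simp only [snd_mul, fst_mul, map_mul, smul_add, mul_smul]
    module

instance : CommRing (Extension f) :=
  { (inferInstance : AddCommGroup (Extension f)), (inferInstance : Mul (Extension f)),
    (inferInstance : One (Extension f)) with
    mul_comm := mul_comm' f
    mul_assoc := mul_assoc' f
    one_mul := one_mul' f
    mul_one := fun u => by rw [mul_comm', one_mul']
    left_distrib := mul_add' f
    right_distrib := fun u v z => by rw [mul_comm', mul_add', mul_comm' f z, mul_comm' f z]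
    zero_mul := fun u => by rw [mul_comm']; ext <;> simp
    mul_zero := fun u => by ext <;> simp }

theorem smul_mul' (c : K) (u v : Extension f) : (c • u) * v = c • (u * v) := by
  ext
  · simp
  · simp only [snd_mul, map_smul, smul_add, smul_eq_mul, LinearMap.smul_apply]; module

instance : Algebra K (Extension f) :=
  Algebra.ofModule (smul_mul' f) (fun c u v => by rw [mul_comm, smul_mul', mul_comm])

/-- The projection `p : B → A`. -/
def proj : Extension f →ₐ[K] A := AlgHom.ofLinearMap (fstL f) rfl (fun _ _ => rfl)
@[simp] theorem proj_apply (u : Extension f) : proj f u = fstL f u := rfl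
/-- The augmentation of the extension. -/
def aug : Extension f →ₐ[K] K := ε.comp (proj f)


end Extension
end Harrison

section Deform
universe w x

theorem numNodes_succ {n : ℕ} {t : BinaryTree Unit} (h : t.numNodes = n + 1) :
    ∃ l r, t = .node () l r ∧ l.numNodes + r.numNodes = n := by
  rcases t with _ | ⟨_, l, r⟩
  · simp at h
  · exact ⟨l, r, rfl, by simpa using h⟩

theorem numNodes_zero {t : BinaryTree Unit} (h : t.numNodes = 0) : t = .nil := by
  rcases t with _ | ⟨_, l, r⟩
  · rfl
  · simp at h

theorem numNodes_one {t : BinaryTree Unit} (h : t.numNodes = 1) : t = .node () .nil .nil := by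
  obtain ⟨l, r, rfl, h⟩ := numNodes_succ h
  rw [numNodes_zero (t := l) (by omega), numNodes_zero (t := r) (by omega)]

theorem numNodes_two {t : BinaryTree Unit} (h : t.numNodes = 2) :
    t = .node () .nil (.node () .nil .nil) ∨ t = .node () (.node () .nil .nil) .nil := by
  obtain ⟨l, r, rfl, h⟩ := numNodes_succ h
  have : l.numNodes = 0 ∧ r.numNodes = 1 ∨ l.numNodes = 1 ∧ r.numNodes = 0 := by omega
  rcases this with ⟨h1, h2⟩ | ⟨h1, h2⟩
  · rw [numNodes_zero h1, numNodes_one h2]; simp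
  · rw [numNodes_zero h2, numNodes_one h1]; simp

theorem numNodes_three {t : BinaryTree Unit} (h : t.numNodes = 3) :
    t = .node () .nil (.node () .nil (.node () .nil .nil)) ∨
    t = .node () .nil (.node () (.node () .nil .nil) .nil) ∨
    t = .node () (.node () .nil .nil) (.node () .nil .nil) ∨
    t = .node () (.node () .nil (.node () .nil .nil)) .nil ∨
    t = .node () (.node () (.node () .nil .nil) .nil) .nil := by
  obtain ⟨l, r, rfl, h⟩ := numNodes_succ h
  have : l.numNodes = 0 ∧ r.numNodes = 2 ∨ l.numNodes = 1 ∧ r.numNodes = 1 ∨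
      l.numNodes = 2 ∧ r.numNodes = 0 := by omega
  rcases this with ⟨a, b⟩ | ⟨a, b⟩ | ⟨a, b⟩
  · rw [numNodes_zero a]; rcases numNodes_two b with rfl | rfl <;> simp
  · rw [numNodes_one a, numNodes_one b]; simp
  · rw [numNodes_zero b]; rcases numNodes_two a with rfl | rfl <;> simp

theorem treeSide_face {t : BinaryTree Unit} (h : t.numNodes = 4) :
    (treeSide 0 (delLeaf 3 t) = treeSide 0 t ∧ treeSide 2 (delLeaf 3 t) = treeSide 0 (delLeaf 0 t) ∧
      treeSide 3 t = treeSide 2 (delLeaf 0 t)) ∧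
    (treeSide 0 (delLeaf 2 t) = treeSide 0 t ∧ treeSide 2 t = treeSide 1 (delLeaf 0 t) ∧
      treeSide 2 (delLeaf 2 t) = treeSide 3 (delLeaf 0 t)) ∧
    (treeSide 1 (delLeaf 3 t) = treeSide 1 t ∧ treeSide 3 (delLeaf 3 t) = treeSide 0 (delLeaf 1 t) ∧
      treeSide 2 (delLeaf 1 t) = treeSide 2 (delLeaf 0 t)) ∧
    (treeSide 1 (delLeaf 4 t) = treeSide 1 t ∧ treeSide 3 (delLeaf 4 t) = treeSide 1 (delLeaf 1 t) ∧
      treeSide 3 (delLeaf 1 t) = treeSide 4 t) ∧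
    (treeSide 1 (delLeaf 2 t) = treeSide 0 (delLeaf 4 t) ∧
      treeSide 2 (delLeaf 4 t) = treeSide 1 (delLeaf 0 t) ∧
      treeSide 3 (delLeaf 2 t) = treeSide 4 t) := by
  obtain ⟨l, r, rfl, h⟩ := numNodes_succ h
  have : l.numNodes = 0 ∧ r.numNodes = 3 ∨ l.numNodes = 1 ∧ r.numNodes = 2 ∨
      l.numNodes = 2 ∧ r.numNodes = 1 ∨ l.numNodes = 3 ∧ r.numNodes = 0 := by omega
  rcases this with ⟨a, b⟩ | ⟨a, b⟩ | ⟨a, b⟩ | ⟨a, b⟩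
  · rw [numNodes_zero a]
    rcases numNodes_three b with rfl | rfl | rfl | rfl | rfl <;>
      exact ⟨⟨rfl, rfl, rfl⟩, ⟨rfl, rfl, rfl⟩, ⟨rfl, rfl, rfl⟩, ⟨rfl, rfl, rfl⟩, rfl, rfl, rfl⟩
  · rw [numNodes_one a]
    rcases numNodes_two b with rfl | rfl <;>
      exact ⟨⟨rfl, rfl, rfl⟩, ⟨rfl, rfl, rfl⟩, ⟨rfl, rfl, rfl⟩, ⟨rfl, rfl, rfl⟩, rfl, rfl, rfl⟩
  · rw [numNodes_one b]
    rcases numNodes_two a with rfl | rfl <;>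
      exact ⟨⟨rfl, rfl, rfl⟩, ⟨rfl, rfl, rfl⟩, ⟨rfl, rfl, rfl⟩, ⟨rfl, rfl, rfl⟩, rfl, rfl, rfl⟩
  · rw [numNodes_zero b]
    rcases numNodes_three a with rfl | rfl | rfl | rfl | rfl <;>
      exact ⟨⟨rfl, rfl, rfl⟩, ⟨rfl, rfl, rfl⟩, ⟨rfl, rfl, rfl⟩, ⟨rfl, rfl, rfl⟩, rfl, rfl, rfl⟩

/-- The map `g ⊗ id : V ⊗ D → K ⊗ D = D`. -/
def contract {V : Type*} [AddCommGroup V] [Module K V] (g : V →ₗ[K] K) : V ⊗[K] D →ₗ[K] D :=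
  (TensorProduct.lid K D).toLinearMap ∘ₗ LinearMap.rTensor D g

@[simp] theorem contract_tmul {V : Type*} [AddCommGroup V] [Module K V] (g : V →ₗ[K] K) (a : V)
    (d : D) : contract g (a ⊗ₜ[K] d) = g a • d := by simp [contract]

/-- A deformation of the dialgebra `D` with base `A` (augmented by `ε`): an `A`-dialgebra structure on
`A ⊗ D` such that `ε ⊗ id : A ⊗ D → D` is a morphism of dialgebras. -/
structure Deformation (𝒟 : Dialgebra K D) {A : Type w} [CommRing A] [Algebra K A]
    (ε : A →ₐ[K] K) extends Dialgebra A (A ⊗[K] D) where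
  compat : ∀ s u v, contract ε.toLinearMap (op s u v) =
    𝒟.op s (contract ε.toLinearMap u) (contract ε.toLinearMap v)

variable {A : Type w} [CommRing A] [Algebra K A]
variable {𝒟 : Dialgebra K D} {ε : A →ₐ[K] K} (η : Deformation 𝒟 ε) (f : harrisonCocycles ε K)
open Extension

/-- `Q = q ⊗ id : A ⊗ D → B ⊗ D`. -/
def liftQ : A ⊗[K] D →ₗ[K] Extension f ⊗[K] D := LinearMap.rTensor D (inlL f)
/-- `P = p ⊗ id : B ⊗ D → A ⊗ D`. -/
def liftP : Extension f ⊗[K] D →ₗ[K] A ⊗[K] D := LinearMap.rTensor D (fstL f)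
/-- `I = i ⊗ id : D = K ⊗ D → B ⊗ D`. -/
def liftI : D →ₗ[K] Extension f ⊗[K] D := TensorProduct.mk K (Extension f) D (inrL f 1)
/-- `E = ε ⊗ id : B ⊗ D → D`. -/
def liftE : Extension f ⊗[K] D →ₗ[K] D := contract (Extension.aug f).toLinearMap
/-- The retraction of `B ⊗ D` onto `D` complementary to `Q`; on `ker P = I(D)` it is the inverse
of `I`. -/
def liftS : Extension f ⊗[K] D →ₗ[K] D := contract (sndL f)

/-- The `B`-bilinear operations `{ , }` on `B ⊗ D` that lift the products of the deformation:
`{1 ⊗ x, 1 ⊗ y} = Q (1 ⊗ x * 1 ⊗ y)`. They satisfy `P {u, v} = P u * P v`, `{I d, u} = I (d * E u)`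
and `{u, I d} = I (E u * d)`, see `liftP_liftOp`, `liftOp_I_left` and `liftOp_I_right`. -/
def liftOp (s : Side) :
    Extension f ⊗[K] D →ₗ[Extension f] Extension f ⊗[K] D →ₗ[Extension f] Extension f ⊗[K] D :=
  ((LinearMap.liftBaseChangeEquiv (R := K) (M := D) (N := Extension f ⊗[K] D)
      (Extension f)).toLinearMap.restrictScalars K ∘ₗ
    LinearMap.mk₂ K (fun x y => liftQ f (η.op s (1 ⊗ₜ x) (1 ⊗ₜ y)))
      (fun x x' y => by simp [TensorProduct.tmul_add])
      (fun c x y => by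
        rw [TensorProduct.tmul_smul, ← algebraMap_smul A c (1 ⊗ₜ[K] x : A ⊗[K] D), map_smul,
          LinearMap.smul_apply, algebraMap_smul, map_smul])
      (fun x y y' => by simp [TensorProduct.tmul_add])
      (fun c x y => by
        rw [TensorProduct.tmul_smul, ← algebraMap_smul A c (1 ⊗ₜ[K] y : A ⊗[K] D), map_smul,
          algebraMap_smul, map_smul])).liftBaseChange (Extension f)

theorem liftOp_tmul (s : Side) (b c : Extension f) (x y : D) :
    liftOp η f s (b ⊗ₜ x) (c ⊗ₜ y) = (b * c) • liftQ f (η.op s (1 ⊗ₜ x) (1 ⊗ₜ y)) := by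
  simp [liftOp, mul_smul]


theorem liftP_smul (b : Extension f) (w : Extension f ⊗[K] D) :
    liftP f (b • w) = fstL f b • liftP f w := by
  induction w with
  | zero => simp
  | add u v hu hv => simp [smul_add, hu, hv]
  | tmul c d => simp [liftP, TensorProduct.smul_tmul']

theorem liftP_liftQ (u : A ⊗[K] D) : liftP f (liftQ f u) = u := by
  induction u with
  | zero => simp
  | add u v hu hv => simp [hu, hv]
  | tmul c d => simp [liftP, liftQ]

theorem op_tmul (s : Side) (a b : A) (x y : D) :
    η.op s (a ⊗ₜ x) (b ⊗ₜ y) = (a * b) • η.op s (1 ⊗ₜ x) (1 ⊗ₜ y) := by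
  have h1 : (a ⊗ₜ[K] x : A ⊗[K] D) = a • (1 ⊗ₜ x) := by simp [TensorProduct.smul_tmul']
  have h2 : (b ⊗ₜ[K] y : A ⊗[K] D) = b • (1 ⊗ₜ y) := by simp [TensorProduct.smul_tmul']
  rw [h1, h2, map_smul, map_smul, LinearMap.smul_apply, smul_smul, mul_comm]

theorem liftP_liftOp (s : Side) (u v : Extension f ⊗[K] D) :
    liftP f (liftOp η f s u v) = η.op s (liftP f u) (liftP f v) := by
  induction u with
  | zero => simp
  | add u u' hu hv => simp [hu, hv]
  | tmul b x =>
    induction v with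
    | zero => simp
    | add u u' hu hv => simp [hu, hv]
    | tmul c y =>
      rw [liftOp_tmul, liftP_smul, liftP_liftQ, fst_mul]
      simp only [liftP, LinearMap.rTensor_tmul]
      rw [op_tmul η s (fstL f b)]

theorem liftE_eq (u : Extension f ⊗[K] D) :
    liftE f u = contract ε.toLinearMap (liftP f u) := by
  induction u with
  | zero => simp
  | add u u' hu hv => simp [hu, hv]
  | tmul b x => simp [liftE, liftP, Extension.aug, Extension.proj_apply]

theorem liftE_liftOp (s : Side) (u v : Extension f ⊗[K] D) :
    liftE f (liftOp η f s u v) = 𝒟.op s (liftE f u) (liftE f v) := by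
  simp only [liftE_eq, liftP_liftOp, η.compat]

theorem liftE_one (x : D) : liftE f (1 ⊗ₜ x) = x := by simp [liftE]

theorem liftS_liftI (d : D) : liftS f (liftI f d) = d := by simp [liftS, liftI]

theorem eq_liftI (w : Extension f ⊗[K] D) : w = liftQ f (liftP f w) + liftI f (liftS f w) := by
  induction w with
  | zero => simp
  | add u v hu hv =>
    simp only [map_add]
    nth_rewrite 1 [hu, hv]
    abel
  | tmul b x =>
    have : b = inlL f (fstL f b) + sndL f b • inrL f 1 := by ext <;> simp
    nth_rewrite 1 [this]
    simp only [TensorProduct.add_tmul, liftQ, liftP, liftS, liftI, LinearMap.rTensor_tmul,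
      contract_tmul, TensorProduct.mk_apply, TensorProduct.smul_tmul]

theorem smul_liftI (b : Extension f) (d : D) : b • liftI f d = liftI f (ε (fstL f b) • d) := by
  have : b * inrL f 1 = ε (fstL f b) • inrL f 1 := by ext <;> simp
  simp only [liftI, TensorProduct.mk_apply, TensorProduct.smul_tmul', smul_eq_mul, this,
    TensorProduct.smul_tmul, map_smul]

theorem inr_smul (w : Extension f ⊗[K] D) : inrL f 1 • w = liftI f (liftE f w) := by
  induction w with
  | zero => simp
  | add u v hu hv => simp only [smul_add, map_add, hu, hv]
  | tmul b x =>
    have : b * inrL f 1 = ε (fstL f b) • inrL f 1 := by ext <;> simp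
    simp only [liftI, liftE, TensorProduct.mk_apply, TensorProduct.smul_tmul', smul_eq_mul,
      mul_comm _ b, this, contract_tmul, TensorProduct.smul_tmul]
    rfl

theorem liftI_eq (d : D) : liftI f d = inrL f 1 • (1 ⊗ₜ d) := by
  simp [liftI, TensorProduct.smul_tmul']

theorem liftOp_I_left (s : Side) (d : D) (u : Extension f ⊗[K] D) :
    liftOp η f s (liftI f d) u = liftI f (𝒟.op s d (liftE f u)) := by
  rw [liftI_eq, map_smul, LinearMap.smul_apply, inr_smul, liftE_liftOp, liftE_one]

theorem liftOp_I_right (s : Side) (u : Extension f ⊗[K] D) (d : D) :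
    liftOp η f s u (liftI f d) = liftI f (𝒟.op s (liftE f u) d) := by
  rw [liftI_eq, map_smul, inr_smul, liftE_liftOp, liftE_one]

theorem op_face (y : Y 3) (u v w : A ⊗[K] D) : η.op (y.side 0) u (η.op (y.side 2) v w) =
    η.op (y.side 3) (η.op (y.side 1) u v) w := by
  simp only [Y.side]
  rcases numNodes_three y.2 with h | h | h | h | h <;> rw [h]
  · exact η.assoc_left _ _ _
  · exact (η.bar_left _ _ _).symm
  · exact (η.assoc_mid _ _ _).symm
  · exact (η.bar_right _ _ _).symm
  · exact η.assoc_right _ _ _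

/-- The failure of the dialgebra axioms for the operations `{ , }`. With `⊣`, `⊢` standing for the two
operations, its values at the trees `[321]`, `[312]`, `[131]`, `[213]`, `[123]` are
`u ⊣ (v ⊣ w) - (u ⊣ v) ⊣ w`, `u ⊣ (v ⊢ w) - (u ⊣ v) ⊣ w`, `u ⊢ (v ⊣ w) - (u ⊢ v) ⊣ w`,
`u ⊢ (v ⊢ w) - (u ⊣ v) ⊢ w` and `u ⊢ (v ⊢ w) - (u ⊢ v) ⊢ w`. -/
def obsPhi (y : Y 3) (u v w : Extension f ⊗[K] D) : Extension f ⊗[K] D :=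
  liftOp η f (y.side 0) u (liftOp η f (y.side 2) v w) -
    liftOp η f (y.side 3) (liftOp η f (y.side 1) u v) w

theorem liftP_obsPhi (y : Y 3) (u v w : Extension f ⊗[K] D) : liftP f (obsPhi η f y u v w) = 0 := by
  rw [obsPhi, map_sub, liftP_liftOp, liftP_liftOp, liftP_liftOp, liftP_liftOp, op_face, sub_self]

/-- The obstruction cochain: the map induced by `obsPhi` from `D^3 = ((B ⊗ D) / ker E)^3` to
`ker P = D`, see `obsPhi_eq`. -/
def obsCochain : CY (D := D) K 3 := fun y =>
  MultilinearMap.mk' (fun a => liftS f (obsPhi η f y (1 ⊗ₜ a 0) (1 ⊗ₜ a 1) (1 ⊗ₜ a 2)))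
    (fun a i x x' => by
      fin_cases i <;> simp [obsPhi, TensorProduct.tmul_add] <;> abel)
    (fun a i c x => by
      fin_cases i <;> simp [obsPhi, smul_sub])

theorem obsCochain_apply (y : Y 3) (a : Fin 3 → D) : obsCochain η f y a =
    liftS f (obsPhi η f y (1 ⊗ₜ a 0) (1 ⊗ₜ a 1) (1 ⊗ₜ a 2)) := rfl

theorem obsPhi_one (y : Y 3) (a b c : D) : obsPhi η f y (1 ⊗ₜ a) (1 ⊗ₜ b) (1 ⊗ₜ c) =
      liftI f (obsCochain η f y ![a, b, c]) := by
  have h := eq_liftI f (obsPhi η f y (1 ⊗ₜ a) (1 ⊗ₜ b) (1 ⊗ₜ c))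
  rw [liftP_obsPhi, map_zero, zero_add] at h
  exact h

theorem obsPhi_eq (y : Y 3) (u v w : Extension f ⊗[K] D) :
    obsPhi η f y u v w =
      liftI f (obsCochain η f y ![liftE f u, liftE f v, liftE f w]) := by
  have key : ∀ a b c : D, obsCochain η f y ![a, b, c] =
      liftS f (obsPhi η f y (1 ⊗ₜ a) (1 ⊗ₜ b) (1 ⊗ₜ c)) := fun _ _ _ => rfl
  induction u with
  | zero => simp [key, obsPhi]
  | add u u' hu hv =>
    rw [show obsPhi η f y (u + u') v w = obsPhi η f y u v w + obsPhi η f y u' v w by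
      simp only [obsPhi, map_add, LinearMap.add_apply]; abel, hu, hv, ← map_add]
    congr 1
    simp only [key, obsPhi, map_add, LinearMap.add_apply, TensorProduct.tmul_add, map_sub]; abel
  | tmul b x =>
    induction v with
    | zero => simp [key, obsPhi]
    | add u u' hu hv =>
      rw [show ∀ v, obsPhi η f y v (u + u') w = obsPhi η f y v u w + obsPhi η f y v u' w by
        intro v; simp only [obsPhi, map_add, LinearMap.add_apply]; abel, hu, hv, ← map_add]
      congr 1
      simp only [key, obsPhi, map_add, LinearMap.add_apply, TensorProduct.tmul_add, map_sub]; abel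
    | tmul c z =>
      induction w with
      | zero => simp [key, obsPhi]
      | add u u' hu hv =>
        rw [show ∀ v w, obsPhi η f y v w (u + u') = obsPhi η f y v w u + obsPhi η f y v w u' by
          intro v w; simp only [obsPhi, map_add]; abel, hu, hv, ← map_add]
        congr 1
        simp only [key, obsPhi, map_add, TensorProduct.tmul_add, map_sub]; abel
      | tmul e t =>
        have h (b : Extension f) (x : D) : b ⊗ₜ[K] x = b • ((1 : Extension f) ⊗ₜ[K] x) := by
          simp [TensorProduct.smul_tmul']
        have h2 (b : Extension f) (x : D) : liftE f (b ⊗ₜ x) = ε (fstL f b) • x := by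
          simp [liftE, Extension.aug]
        have h3 : obsPhi η f y (b ⊗ₜ x) (c ⊗ₜ z) (e ⊗ₜ t) =
            (b * (c * e)) • obsPhi η f y (1 ⊗ₜ x) (1 ⊗ₜ z) (1 ⊗ₜ t) := by
          rw [h b, h c, h e]
          simp only [obsPhi, map_smul, LinearMap.smul_apply, smul_smul, smul_sub]
          congr 2 <;> ring
        have h4 : (![ε (fstL f b) • x, ε (fstL f c) • z, ε (fstL f e) • t] : Fin 3 → D) =
            fun i => ![ε (fstL f b), ε (fstL f c), ε (fstL f e)] i • ![x, z, t] i := by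
          ext i; fin_cases i <;> rfl
        rw [h3, obsPhi_one, smul_liftI, h2, h2, h2, h4, MultilinearMap.map_smul_univ]
        simp [Fin.prod_univ_three, mul_assoc]

/-- The identity behind the cocycle condition; it holds for any two bilinear operations. -/
theorem pentagon (y : Y 4) (u v w z : Extension f ⊗[K] D) :
    liftOp η f (y.side 0) u (obsPhi η f (y.face 0) v w z) -
      obsPhi η f (y.face 1) (liftOp η f (y.side 1) u v) w z +
      obsPhi η f (y.face 2) u (liftOp η f (y.side 2) v w) z -
      obsPhi η f (y.face 3) u v (liftOp η f (y.side 3) w z) +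
      liftOp η f (y.side 4) (obsPhi η f (y.face 4) u v w) z = 0 := by
  obtain ⟨⟨h1, h2, h3⟩, ⟨h4, h5, h6⟩, ⟨h7, h8, h9⟩, ⟨h10, h11, h12⟩, h13, h14, h15⟩ :=
    treeSide_face y.2
  simp only [obsPhi, map_sub, LinearMap.sub_apply, Y.side, Y.face, h1, h2, h3, h4, h5, h6, h7, h8,
    h9, h10, h11, h12, h13, h14, h15]
  abel

theorem obsCochain_mem (𝒟 : Dialgebra K D) (η : Deformation 𝒟 ε) :
    obsCochain η f ∈ cocycles 𝒟 3 := by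
  have hvec (a : Fin 3 → D) : a = ![a 0, a 1, a 2] := by ext i; fin_cases i <;> rfl
  have key (y : Y 3) (a : Fin 3 → D) :
      liftI f (obsCochain η f y a) = obsPhi η f y (1 ⊗ₜ a 0) (1 ⊗ₜ a 1) (1 ⊗ₜ a 2) := by
    rw [obsPhi_one, ← hvec]
  rw [cocycles, LinearMap.mem_ker]
  ext y a
  have hinj : Function.Injective (liftI (D := D) f) := fun d d' h => by
    simpa [liftS_liftI] using congrArg (liftS f) h
  apply hinj
  have h := pentagon η f y (1 ⊗ₜ a 0) (1 ⊗ₜ a 1) (1 ⊗ₜ a 2) (1 ⊗ₜ a 3)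
  simp only [obsPhi_eq, liftE_liftOp, liftE_one, liftOp_I_left, liftOp_I_right] at h
  rw [Pi.zero_apply, zero_apply, map_zero, ← h]
  simp only [← map_add, ← map_sub]
  congr 1
  have c0 : (fun i : Fin 3 => a i.succ) = ![a 1, a 2, a 3] := hvec _
  have c1 : Fin.contractNth (Fin.castSucc (0 : Fin 3)) (fun x z => 𝒟.op (y.side 1) x z) a =
    ![𝒟.op (y.side 1) (a 0) (a 1), a 2, a 3] := hvec _
  have c2 : Fin.contractNth (Fin.castSucc (1 : Fin 3)) (fun x z => 𝒟.op (y.side 2) x z) a =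
    ![a 0, 𝒟.op (y.side 2) (a 1) (a 2), a 3] := hvec _
  have c3 : Fin.contractNth (Fin.castSucc (2 : Fin 3)) (fun x z => 𝒟.op (y.side 3) x z) a =
    ![a 0, a 1, 𝒟.op (y.side 3) (a 2) (a 3)] := hvec _
  have c4 : (fun i : Fin 3 => a i.castSucc) = ![a 0, a 1, a 2] := hvec _
  have hδ : delta 𝒟 3 (obsCochain η f) y a =
      faceZero (𝒟.op (y.side 0)) (obsCochain η f (y.face 0)) a +
      ((-1 : K) ^ 1 • precompOp (𝒟.op (y.side 1)) 0 (obsCochain η f (y.face 1)) a +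
        (-1 : K) ^ 2 • precompOp (𝒟.op (y.side 2)) 1 (obsCochain η f (y.face 2)) a +
        (-1 : K) ^ 3 • precompOp (𝒟.op (y.side 3)) 2 (obsCochain η f (y.face 3)) a) +
      (-1 : K) ^ 4 • faceLast (𝒟.op (y.side 4)) (obsCochain η f (y.face 4)) a := by
    simp [delta, Fin.sum_univ_three]
  rw [hδ, faceZero_apply, faceLast_apply, precompOp_apply, precompOp_apply, precompOp_apply,
    c0, c1, c2, c3, c4]
  have : a (Fin.last 3) = a 3 := rfl
  rw [this]
  module


theorem liftS_inl_smul (a : A) (v : A ⊗[K] D) :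
    liftS f (inlL f a • liftQ f v) = contract (f.1 a) v := by
  induction v with
  | zero => simp
  | add u v hu hv => simp only [map_add, smul_add, hu, hv]
  | tmul b d => simp [liftS, liftQ, TensorProduct.smul_tmul']

theorem liftOp_one_Q (s : Side) (x : D) (a : A) (d : D) :
    liftOp η f s (1 ⊗ₜ x) (liftQ f (a ⊗ₜ d)) =
      inlL f a • liftQ f (η.op s (1 ⊗ₜ x) (1 ⊗ₜ d)) := by
  have h : liftQ f (a ⊗ₜ[K] d) = inlL f a ⊗ₜ d := by simp [liftQ]
  rw [h, liftOp_tmul, one_mul]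

theorem liftOp_Q_one (s : Side) (x : D) (a : A) (d : D) :
    liftOp η f s (liftQ f (a ⊗ₜ d)) (1 ⊗ₜ x) =
      inlL f a • liftQ f (η.op s (1 ⊗ₜ d) (1 ⊗ₜ x)) := by
  have h : liftQ f (a ⊗ₜ[K] d) = inlL f a ⊗ₜ d := by simp [liftQ]
  rw [h, liftOp_tmul, mul_one]

theorem liftOp_one_one (s : Side) (x y : D) : liftOp η f s (1 ⊗ₜ x) (1 ⊗ₜ y) =
    liftQ f (η.op s (1 ⊗ₜ x) (1 ⊗ₜ y)) := by
  rw [liftOp_tmul, one_mul, one_smul]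

theorem contract_linear {V : Type*} [AddCommGroup V] [Module K V] (g h : V →ₗ[K] K) (r : K)
    (v : V ⊗[K] D) : contract (r • g + h) v = r • contract g v + contract h v := by
  induction v with
  | zero => simp
  | add u v hu hv => simp only [map_add, hu, hv]; module
  | tmul b d => simp only [contract_tmul, LinearMap.add_apply, LinearMap.smul_apply]; module

theorem liftS_liftOp_Q_right (s : Side) (x : D) (u : A ⊗[K] D) (f g : harrisonCocycles ε K) (r : K) :
    liftS (r • f + g) (liftOp η (r • f + g) s (1 ⊗ₜ x) (liftQ (r • f + g) u)) =
    r • liftS f (liftOp η f s (1 ⊗ₜ x) (liftQ f u)) +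
      liftS g (liftOp η g s (1 ⊗ₜ x) (liftQ g u)) := by
  induction u with
  | zero => simp
  | add u v hu hv => simp only [map_add, hu, hv]; module
  | tmul a d =>
    simp only [liftOp_one_Q, liftS_inl_smul]
    exact contract_linear _ _ _ _

theorem liftS_liftOp_Q_left (s : Side) (x : D) (u : A ⊗[K] D) (f g : harrisonCocycles ε K) (r : K) :
    liftS (r • f + g) (liftOp η (r • f + g) s (liftQ (r • f + g) u) (1 ⊗ₜ x)) =
    r • liftS f (liftOp η f s (liftQ f u) (1 ⊗ₜ x)) +
      liftS g (liftOp η g s (liftQ g u) (1 ⊗ₜ x)) := by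
  induction u with
  | zero => simp
  | add u v hu hv => simp only [map_add, LinearMap.add_apply, hu, hv]; module
  | tmul a d =>
    simp only [liftOp_Q_one, liftS_inl_smul]
    exact contract_linear _ _ _ _

theorem obsCochain_linear (f g : harrisonCocycles ε K) (r : K) :
    obsCochain η (r • f + g) = r • obsCochain η f + obsCochain η g := by
  ext y a
  simp only [Pi.add_apply, Pi.smul_apply, add_apply, smul_apply,
    obsCochain_apply, obsPhi, map_sub, liftOp_one_one, liftS_liftOp_Q_right, liftS_liftOp_Q_left]
  module

/-- The obstruction cocycle as a linear function of the Harrison cocycle. -/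
def obsCocycle : harrisonCocycles ε K →ₗ[K] cocycles 𝒟 3 where
  toFun f := ⟨obsCochain η f, obsCochain_mem f 𝒟 η⟩
  map_add' f g := Subtype.ext (by simpa using obsCochain_linear η f g 1)
  map_smul' r f := Subtype.ext (by
    have h0 : obsCochain η (0 : harrisonCocycles ε K) = 0 := by
      simpa using obsCochain_linear η (0 : harrisonCocycles ε K) 0 1
    simpa [h0] using obsCochain_linear η f 0 r)

theorem contract_harrD1 (g : A →ₗ[K] K) (a : A) (v : A ⊗[K] D) :
    contract (harrisonCoboundary ε K g a) v =
      ε a • contract g v - contract g (a • v) + g a • contract ε.toLinearMap v := by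
  induction v with
  | zero => simp
  | add u v hu hv => simp only [map_add, smul_add, hu, hv]; module
  | tmul b d =>
    simp only [contract_tmul, harrisonCoboundary, LinearMap.coe_mk, AddHom.coe_mk, LinearMap.mk₂_apply,
      TensorProduct.smul_tmul', AlgHom.toLinearMap_apply, smul_eq_mul]
    module

theorem compat_one (s : Side) (x y : D) :
    contract ε.toLinearMap (η.op s (1 ⊗ₜ x) (1 ⊗ₜ y)) = 𝒟.op s x y := by
  simpa using η.compat s (1 ⊗ₜ x) (1 ⊗ₜ y)

theorem one_tmul_smul (c : K) (d : D) : (1 ⊗ₜ[K] (c • d) : A ⊗[K] D) = algebraMap K A c • (1 ⊗ₜ d) := by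
  rw [algebraMap_smul, TensorProduct.tmul_smul]

theorem op_one_smul_right (s : Side) (u : A ⊗[K] D) (c : K) (d : D) :
    η.op s u (1 ⊗ₜ (c • d)) = c • η.op s u (1 ⊗ₜ d) := by
  rw [one_tmul_smul, map_smul, algebraMap_smul]

theorem op_one_smul_left (s : Side) (u : A ⊗[K] D) (c : K) (d : D) :
    η.op s (1 ⊗ₜ (c • d)) u = c • η.op s (1 ⊗ₜ d) u := by
  rw [one_tmul_smul, map_smul, LinearMap.smul_apply, algebraMap_smul]

theorem obs_right {f : harrisonCocycles ε K} {g : A →ₗ[K] K} (hf : f.1 = harrisonCoboundary ε K g) (s : Side) (x : D)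
    (u : A ⊗[K] D) : liftS f (liftOp η f s (1 ⊗ₜ x) (liftQ f u)) =
      contract g (η.op s (1 ⊗ₜ x) (1 ⊗ₜ contract ε.toLinearMap u)) -
        contract g (η.op s (1 ⊗ₜ x) u) + 𝒟.op s x (contract g u) := by
  induction u with
  | zero => simp
  | add u v hu hv => simp only [map_add, hu, hv, TensorProduct.tmul_add]; abel
  | tmul a d =>
    rw [liftOp_one_Q, liftS_inl_smul, hf, contract_harrD1, compat_one, op_tmul η s 1 a, one_mul,
      contract_tmul, contract_tmul, op_one_smul_right]
    simp only [map_smul, AlgHom.toLinearMap_apply]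

theorem obs_left {f : harrisonCocycles ε K} {g : A →ₗ[K] K} (hf : f.1 = harrisonCoboundary ε K g) (s : Side) (x : D)
    (u : A ⊗[K] D) : liftS f (liftOp η f s (liftQ f u) (1 ⊗ₜ x)) =
      contract g (η.op s (1 ⊗ₜ contract ε.toLinearMap u) (1 ⊗ₜ x)) -
        contract g (η.op s u (1 ⊗ₜ x)) + 𝒟.op s (contract g u) x := by
  induction u with
  | zero => simp
  | add u v hu hv =>
    simp only [map_add, hu, hv, TensorProduct.tmul_add, LinearMap.add_apply]; abel
  | tmul a d =>
    rw [liftOp_Q_one, liftS_inl_smul, hf, contract_harrD1, compat_one, op_tmul η s a 1, mul_one,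
      contract_tmul, contract_tmul, op_one_smul_left]
    simp only [map_smul, LinearMap.smul_apply, AlgHom.toLinearMap_apply]

theorem side_face (y : Y 3) : (y.face 0).side 0 = y.side 2 ∧ (y.face 1).side 0 = y.side 3 ∧
    (y.face 2).side 0 = y.side 0 ∧ (y.face 3).side 0 = y.side 1 := by
  simp only [Y.side, Y.face]
  rcases numNodes_three y.2 with h | h | h | h | h <;> rw [h] <;> exact ⟨rfl, rfl, rfl, rfl⟩

/-- If `f` is the coboundary of `g`, this is a cochain whose coboundary is the obstruction cocycle. -/
def obsPrim (g : A →ₗ[K] K) : CY (D := D) K 2 := fun y =>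
  MultilinearMap.mk' (fun a => contract g (η.op (y.side 0) (1 ⊗ₜ a 0) (1 ⊗ₜ a 1)))
    (fun a i x x' => by fin_cases i <;> simp [TensorProduct.tmul_add])
    (fun a i c x => by
      fin_cases i <;> simp [-TensorProduct.tmul_smul, one_tmul_smul, -algebraMap_smul] <;>
      simp)

theorem obsCochain_coboundary {f : harrisonCocycles ε K} {g : A →ₗ[K] K} (hf : f.1 = harrisonCoboundary ε K g) :
    obsCochain η f = delta 𝒟 2 (obsPrim η g) := by
  obtain hs := side_face
  have hP (y : Y 2) (b c : D) : obsPrim η g y ![b, c] =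
      contract g (η.op (y.side 0) (1 ⊗ₜ b) (1 ⊗ₜ c)) := rfl
  have hvec (a : Fin 2 → D) : a = ![a 0, a 1] := by ext i; fin_cases i <;> rfl
  ext y a
  have c0 : (fun i : Fin 2 => a i.succ) = ![a 1, a 2] := hvec _
  have c1 : Fin.contractNth (Fin.castSucc (0 : Fin 2)) (fun x z => 𝒟.op (y.side 1) x z) a =
    ![𝒟.op (y.side 1) (a 0) (a 1), a 2] := hvec _
  have c2 : Fin.contractNth (Fin.castSucc (1 : Fin 2)) (fun x z => 𝒟.op (y.side 2) x z) a =
    ![a 0, 𝒟.op (y.side 2) (a 1) (a 2)] := hvec _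
  have c3 : (fun i : Fin 2 => a i.castSucc) = ![a 0, a 1] := hvec _
  have hδ : delta 𝒟 2 (obsPrim η g) y a =
      faceZero (𝒟.op (y.side 0)) (obsPrim η g (y.face 0)) a +
      ((-1 : K) ^ 1 • precompOp (𝒟.op (y.side 1)) 0 (obsPrim η g (y.face 1)) a +
        (-1 : K) ^ 2 • precompOp (𝒟.op (y.side 2)) 1 (obsPrim η g (y.face 2)) a) +
      (-1 : K) ^ 3 • faceLast (𝒟.op (y.side 3)) (obsPrim η g (y.face 3)) a := by
    simp [delta, Fin.sum_univ_two]
  rw [hδ, faceZero_apply, faceLast_apply, precompOp_apply, precompOp_apply, c0, c1, c2, c3]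
  simp only [hP, (hs y).1, (hs y).2.1, (hs y).2.2.1, (hs y).2.2.2]
  rw [obsCochain_apply, obsPhi, map_sub, liftOp_one_one, liftOp_one_one, obs_right η hf,
    obs_left η hf, op_face, compat_one, compat_one]
  have : a (Fin.last 2) = a 2 := rfl
  rw [this]
  module

/-- The obstruction map `H^2_Harr(A; K) → HY^3(D,D)` of a deformation with base `A`: it sends the
class of `f` to the obstruction to extending the deformation to the extension of `A` given by `f`. -/
def obstruction (η : Deformation 𝒟 ε) : HarrisonH2 ε K →ₗ[K] HY 𝒟 3 :=
  Submodule.mapQ _ _ (obsCocycle η) (by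
    rintro f ⟨g, hg⟩
    exact ⟨obsPrim η g, (obsCochain_coboundary η hg.symm).symm⟩)


section Step
variable {B : Type x} [CommRing B] [Algebra K B] {ε' : B →ₐ[K] K}

/-- `η'` is the push-out `φ_* η`. Here `b ⊗_A (a ⊗ x) ∈ B ⊗_A (A ⊗ D) = B ⊗ D` is `b • (φ ⊗ id) (a ⊗ x)`. -/
def IsPushout (φ : A →ₐ[K] B) (η : Deformation 𝒟 ε) (η' : Deformation 𝒟 ε') : Prop :=
  ∀ (s : Side) (b₁ b₂ : B) (u₁ u₂ : A ⊗[K] D),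
    η'.op s (b₁ • LinearMap.rTensor D φ.toLinearMap u₁) (b₂ • LinearMap.rTensor D φ.toLinearMap u₂) =
      (b₁ * b₂) • LinearMap.rTensor D φ.toLinearMap (η.op s u₁ u₂)

/-- `η` is the universal infinitesimal deformation, with base `K ⊕ HY^2(D,D)'`, built from some linear
choice `μ` of cocycles representing the classes in `HY^2(D,D)`. An element of
`A ⊗ D = D ⊕ Hom(HY^2(D,D), D)` is the pair `(x, φ)` with `x = pr u` and `φ α = co u`, and the second
component of `(x₁, φ₁) * (x₂, φ₂)` sends `α` to `μ α (x₁, x₂) + φ₁ α * x₂ + x₁ * φ₂ α`; the first one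
is `x₁ * x₂` by the definition of a deformation. -/
def IsUniversalInfinitesimal (e : A ≃ₐ[K] TrivSqZeroExt K (Module.Dual K (HY 𝒟 2)))
    (η : Deformation 𝒟 ε) : Prop :=
  ∃ μ : HY 𝒟 2 →ₗ[K] cocycles 𝒟 2, (∀ α, Submodule.Quotient.mk (μ α) = α) ∧
    ∀ (s : Side) (u₁ u₂ : A ⊗[K] D) (α : HY 𝒟 2),
      let pr : A ⊗[K] D →ₗ[K] D := contract ε.toLinearMap
      let co : A ⊗[K] D →ₗ[K] D := contract
        (Module.Dual.eval K (HY 𝒟 2) α ∘ₗ TrivSqZeroExt.sndHom K (Module.Dual K (HY 𝒟 2)) ∘ₗ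
          e.toLinearMap)
      co (η.op s u₁ u₂) = (μ α).1 (Y.two s) ![pr u₁, pr u₂] +
        𝒟.op s (co u₁) (pr u₂) + 𝒟.op s (pr u₁) (co u₂)

/-- The cocycle with values in `H^2_Harr(A; K)'` given by a choice `μ` of representing cocycles. -/
def universalCocycle (μ : HarrisonH2 ε K →ₗ[K] harrisonCocycles ε K) : harrisonCocycles ε (Module.Dual K (HarrisonH2 ε K)) :=
  ⟨LinearMap.mk₂ K (fun a b => (LinearMap.applyₗ b ∘ₗ LinearMap.applyₗ a) ∘ₗ (harrisonCocycles ε K).subtype ∘ₗ μ)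
    (fun a b c => by ext; simp) (fun a b c => by ext; simp) (fun a b c => by ext; simp)
    (fun a b c => by ext; simp),
    fun a b => LinearMap.ext fun h => (μ h).2.1 a b,
    fun a b c => LinearMap.ext fun h => (μ h).2.2 a b c⟩

/-- The image in `H^2_Harr(A; K)' ⊆ B` of the dual `HY^3(D,D)' → H^2_Harr(A; K)'` of the obstruction
map. -/
def nextIdeal (η : Deformation 𝒟 ε) (μ : HarrisonH2 ε K →ₗ[K] harrisonCocycles ε K) :
    Ideal (Extension (universalCocycle μ)) :=
  Ideal.span (inrL (universalCocycle μ) '' Set.range (obstruction η).dualMap)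

/-- The next base: the quotient of the extension of `A` by `H^2_Harr(A; K)'` by the image of
`HY^3(D,D)'`. -/
abbrev NextAlgebra (η : Deformation 𝒟 ε) (μ : HarrisonH2 ε K →ₗ[K] harrisonCocycles ε K) : Type (max u w) :=
  Extension (universalCocycle μ) ⧸ nextIdeal η μ

/-- The projection of the next base to `A`. -/
def nextProj (η : Deformation 𝒟 ε) (μ : HarrisonH2 ε K →ₗ[K] harrisonCocycles ε K) : NextAlgebra η μ →ₐ[K] A :=
  Ideal.Quotient.liftₐ (nextIdeal η μ) (proj (universalCocycle μ)) (fun c hc => by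
    have : nextIdeal η μ ≤ RingHom.ker (proj (universalCocycle μ)) := by
      rw [nextIdeal, Ideal.span_le]
      rintro _ ⟨m, -, rfl⟩
      simp [RingHom.mem_ker]
    exact this hc)

/-- `p : B → A` is, up to isomorphism over `A`, the extension of `A` constructed from the deformation
`η` and from some linear choice `μ` of cocycles representing the classes in `H^2_Harr(A; K)`. -/
def IsNextStep (η : Deformation 𝒟 ε) (p : B →ₐ[K] A) : Prop :=
  ∃ μ : HarrisonH2 ε K →ₗ[K] harrisonCocycles ε K, (∀ h, Submodule.Quotient.mk (μ h) = h) ∧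
    ∃ e : B ≃ₐ[K] NextAlgebra η μ, ∀ c, nextProj η μ (e c) = p c

end Step

/-- A sequence of bases `C_k` and deformations `η_k` produced by the inductive construction of a
miniversal deformation of `D`: `C_0 = K`, `C_1 = K ⊕ HY^2(D,D)'` with the universal infinitesimal
deformation `η_1`, and for `k ≥ 1` the algebra `C_{k+1}` is constructed from `(C_k, η_k)`, while
`η_{k+1}` is any deformation with base `C_{k+1}` whose push-out to `C_k` is `η_k`. -/
structure Tower (𝒟 : Dialgebra K D) where
  C : ℕ → Type w
  [commRing : ∀ k, CommRing (C k)]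
  [algebra : ∀ k, Algebra K (C k)]
  ε : ∀ k, C k →ₐ[K] K
  p : ∀ k, C (k + 1) →ₐ[K] C k
  η : ∀ k, Deformation 𝒟 (ε k)
  ε_p : ∀ k, (ε k).comp (p k) = ε (k + 1)
  push : ∀ k, IsPushout (p k) (η (k + 1)) (η k)
  zero : Function.Bijective (ε 0)
  one : ∃ e : C 1 ≃ₐ[K] TrivSqZeroExt K (Module.Dual K (HY 𝒟 2)),
    IsUniversalInfinitesimal e (η 1)
  succ : ∀ k, 1 ≤ k → IsNextStep (η k) (p k)

attribute [instance] Tower.commRing Tower.algebra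

/-- The inverse limit `C = lim C_k`. -/
def Tower.limit {𝒟 : Dialgebra K D} (T : Tower.{u, v, w} 𝒟) : Subalgebra K (∀ k, T.C k) where
  carrier := {c | ∀ k, T.p k (c (k + 1)) = c k}
  mul_mem' hc hd k := by simp [hc k, hd k]
  add_mem' hc hd k := by simp [hc k, hd k]
  algebraMap_mem' r k := by simp

end Deform
end DialgebraDeformation

/-! The limit is presented by lifting a basis of the maximal ideal of `C 1` to elements of `C` and
evaluating power series at them. Three points have to be checked.

Evaluation makes sense at each level because augmentation ideals are nilpotent elementwise: in each
extension the kernel is annihilated by the augmentation ideal (`IsNextStep.mul_eq_zero`). The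
evaluations are compatible with the projections, so they define a map `Φ` to the limit.

Each evaluation is onto `C k`. The decisive fact is that the extension built from representatives of
all Harrison classes creates no new generators: its kernel lies in the square of the augmentation
ideal (`ker_proj_universalCocycle_le`). Otherwise a derivation to `K` that does not vanish on the
kernel would exhibit a nonzero Harrison class as a coboundary. This passes to every quotient over
the old base, hence to `C (k + 1)`, and a Nakayama-type argument (`IsNextStep.subalgebra_eq_top`)
carries surjectivity from one level to the next.

Surjectivity onto each `C k` does not formally give surjectivity onto the limit; this is supplied by
the linear compactness of the power series ring (`exists_forall_algHom_apply_eq`). Finally, `ker Φ`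
is contained in the kernel of the map to `C 1`, where the linear coefficients of a series can be
read off, so it lies in `m ^ 2`. -/

namespace DialgebraDeformation

/-! ### Formal power series: the square of the maximal ideal, evaluation at nilpotents, linear
compactness -/

section PowerSeries

variable {K : Type*} [Field K] {σ : Type*} [Finite σ]

/-- A power series in finitely many variables without terms of degree at most one lies in the square
of the maximal ideal. -/
theorem mem_maximalIdeal_sq (f : MvPowerSeries σ K) (h0 : MvPowerSeries.coeff 0 f = 0)
    (h1 : ∀ i, MvPowerSeries.coeff (Finsupp.single i 1) f = 0) :
    f ∈ IsLocalRing.maximalIdeal (MvPowerSeries σ K) ^ 2 := by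
  classical
  cases nonempty_fintype σ
  have hmem (g : MvPowerSeries σ K) (hg : MvPowerSeries.constantCoeff g = 0) :
      g ∈ IsLocalRing.maximalIdeal (MvPowerSeries σ K) := by
    rw [IsLocalRing.mem_maximalIdeal, mem_nonunits_iff, MvPowerSeries.isUnit_iff_constantCoeff, hg]
    exact not_isUnit_zero
  -- Every nonconstant monomial is assigned to one variable dividing it; `g i` collects the terms of
  -- `f` assigned to `i`, divided by `X i`. Thus no term is counted twice in `∑ X i * g i`.
  let i₀ (s : σ →₀ ℕ) (hs : s ≠ 0) : σ := (Finsupp.support_nonempty_iff.2 hs).choose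
  have hi₀ (s : σ →₀ ℕ) (hs : s ≠ 0) : s (i₀ s hs) ≠ 0 :=
    Finsupp.mem_support_iff.1 (Finsupp.support_nonempty_iff.2 hs).choose_spec
  let g (i : σ) : MvPowerSeries σ K := fun s =>
    if ∃ h : s + Finsupp.single i 1 ≠ 0, i₀ _ h = i then
      MvPowerSeries.coeff (s + Finsupp.single i 1) f else 0
  have hg (i : σ) (s : σ →₀ ℕ) : MvPowerSeries.coeff s (g i) =
      if ∃ h : s + Finsupp.single i 1 ≠ 0, i₀ _ h = i then
        MvPowerSeries.coeff (s + Finsupp.single i 1) f else 0 := rfl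
  have hf : f = ∑ i, MvPowerSeries.X i * g i := by
    ext s
    rw [map_sum]
    have hterm (i : σ) : MvPowerSeries.coeff s (MvPowerSeries.X i * g i) =
        if ∃ h : s ≠ 0, i₀ s h = i then MvPowerSeries.coeff s f else 0 := by
      by_cases hsi : s i = 0
      · rw [if_neg]
        · rw [MvPowerSeries.X, MvPowerSeries.coeff_monomial_mul, if_neg]
          intro hle
          have := hle i
          simp [hsi] at this
        · rintro ⟨h, rfl⟩
          exact hi₀ s h hsi
      · obtain ⟨t, rfl⟩ : ∃ t, s = t + Finsupp.single i 1 := by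
          refine ⟨s - Finsupp.single i 1, (tsub_add_cancel_of_le ?_).symm⟩
          rw [Finsupp.single_le_iff]
          omega
        rw [MvPowerSeries.X, add_comm t, MvPowerSeries.coeff_add_monomial_mul, one_mul, hg,
          add_comm t]
    simp only [hterm]
    by_cases hs : s = 0
    · simp [hs, h0]
    · simp [hs]
  rw [hf, pow_two]
  -- The constant term of `g i` is either zero or the coefficient of `X i` in `f`, which vanishes by
  -- `h1`.
  refine Ideal.sum_mem _ fun i _ => Ideal.mul_mem_mul (hmem _ (by simp)) (hmem _ ?_)
  rw [← MvPowerSeries.coeff_zero_eq_constantCoeff_apply, hg, zero_add, h1, ite_self]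

variable {A : Type*} [CommRing A] [Algebra K A]

/-- A nonzero monomial has all exponents below the nilpotency exponents of the `c i`, and with
finitely many variables such exponent vectors fill a finite box. This is what makes evaluation an
algebraic, finite sum. -/
theorem finite_support_prod_pow {c : σ → A} (hc : ∀ i, IsNilpotent (c i)) :
    (Function.support fun s : σ →₀ ℕ => s.prod fun i e => c i ^ e).Finite := by
  classical
  choose N hN using hc
  refine (Set.finite_Icc 0 (Finsupp.equivFunOnFinite.symm N)).subset fun s hs => ⟨zero_le, ?_⟩
  intro i
  by_contra! hlt
  refine hs ?_
  have hlt' : N i < s i := by simpa using hlt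
  exact Finset.prod_eq_zero (i := i) (Finsupp.mem_support_iff.2 (by omega))
    (pow_eq_zero_of_le hlt'.le (hN i))

/-- Power series can be evaluated at nilpotent elements. -/
theorem exists_algHom_eq_finsum {c : σ → A} (hc : ∀ i, IsNilpotent (c i)) :
    ∃ φ : MvPowerSeries σ K →ₐ[K] A, ∀ f, φ f =
      ∑ᶠ s : σ →₀ ℕ, MvPowerSeries.coeff s f • s.prod fun i e => c i ^ e := by
  -- With discrete topologies on `K` and `A`, nilpotent elements are topologically nilpotent, so the
  -- topological evaluation applies; its infinite sum has finite support.
  let _ : UniformSpace K := ⊥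
  let _ : UniformSpace A := ⊥
  have : DiscreteTopology K := ⟨rfl⟩
  have : DiscreteTopology A := ⟨rfl⟩
  have : DiscreteUniformity K := ⟨rfl⟩
  have : DiscreteUniformity A := ⟨rfl⟩
  have : IsLinearTopology A A := inferInstance
  have : ContinuousSMul K A := ⟨continuous_of_discreteTopology⟩
  have ha : MvPowerSeries.HasEval c :=
    { hpow := fun i => (hc i).isTopologicallyNilpotent
      tendsto_zero := by simp [Filter.cofinite_eq_bot] }
  refine ⟨MvPowerSeries.aeval ha, fun f => ?_⟩
  rw [MvPowerSeries.aeval_eq_sum, tsum_eq_finsum]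
  exact (finite_support_prod_pow hc).subset fun s hs h => hs (by simp [h])

theorem exists_algHom_apply_eq {c : σ → A} (hc : ∀ i, IsNilpotent (c i)) :
    ∃ φ : MvPowerSeries σ K →ₐ[K] A, (∀ f, φ f =
      ∑ᶠ s : σ →₀ ℕ, MvPowerSeries.coeff s f • s.prod fun i e => c i ^ e) ∧
      ∀ i, φ (MvPowerSeries.X i) = c i := by
  classical
  obtain ⟨φ, hφ⟩ := exists_algHom_eq_finsum (K := K) hc
  refine ⟨φ, hφ, fun i => ?_⟩
  rw [hφ, finsum_eq_single _ (Finsupp.single i 1)]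
  · simp
  · intro s hs
    rw [MvPowerSeries.coeff_X, if_neg hs, zero_smul]

/-- Linear compactness of the ring of formal power series: a system of conditions `φ k f = x k`
has a solution if each finite part of it has one. -/
theorem exists_forall_algHom_apply_eq {C : ℕ → Type*} [∀ k, CommRing (C k)] [∀ k, Algebra K (C k)]
    (c : ∀ k, σ → C k) (hc : ∀ k i, IsNilpotent (c k i))
    (φ : ∀ k, MvPowerSeries σ K →ₐ[K] C k) (hφ : ∀ k f, φ k f =
      ∑ᶠ s : σ →₀ ℕ, MvPowerSeries.coeff s f • s.prod fun i e => c k i ^ e)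
    (x : ∀ k, C k) (hx : ∀ N, ∃ f, ∀ k ≤ N, φ k f = x k) : ∃ f, ∀ k, φ k f = x k := by
  classical
  -- The series form the dual of the space of finitely supported families on the monomials. Testing
  -- `φ k f` against a functional `l` is pairing `f` with the finitely supported vector `v ⟨k, l⟩`.
  let v (j : Σ k, Module.Dual K (C k)) : (σ →₀ ℕ) →₀ K :=
    Finsupp.ofSupportFinite (fun s => j.2 (s.prod fun i e => c j.1 i ^ e))
      ((finite_support_prod_pow (hc j.1)).subset fun s hs h => hs (by simp [h]))
  have hv (f : MvPowerSeries σ K) (k : ℕ) (l : Module.Dual K (C k)) :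
      Finsupp.linearCombination K (fun s => MvPowerSeries.coeff s f) (v ⟨k, l⟩) = l (φ k f) := by
    have hfin : (Function.support fun s : σ →₀ ℕ =>
        MvPowerSeries.coeff s f • s.prod fun i e => c k i ^ e).Finite :=
      (finite_support_prod_pow (hc k)).subset fun s hs h => hs (by simp [h])
    rw [hφ, map_finsum l hfin,
      Finsupp.linearCombination_apply, Finsupp.sum, ← finsum_eq_sum_of_support_subset]
    · exact finsum_congr fun s => by simp [v, Finsupp.ofSupportFinite_coe, mul_comm]
    · intro s hs
      rw [Finset.mem_coe, Finsupp.mem_support_iff]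
      exact fun h => hs (by simp [h])
  let b : ((Σ k, Module.Dual K (C k)) →₀ K) →ₗ[K] K :=
    Finsupp.linearCombination K fun j => j.2 (x j.1)
  have hcomb (f : MvPowerSeries σ K) (l : (Σ k, Module.Dual K (C k)) →₀ K)
      (h : ∀ j ∈ l.support, φ j.1 f = x j.1) :
      Finsupp.linearCombination K (fun s => MvPowerSeries.coeff s f)
        (Finsupp.linearCombination K v l) = b l := by
    simp only [b]
    rw [Finsupp.linearCombination_apply K (v := v), Finsupp.linearCombination_apply K l]
    rw [Finsupp.sum, Finsupp.sum, map_sum]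
    refine Finset.sum_congr rfl fun j hj => ?_
    rw [map_smul, hv, h j hj]
  -- The system prescribes the values of a functional on the vectors `v j`. It is solvable exactly
  -- when every linear relation among the `v j` also holds among the prescribed values.
  have hb : b ∈ LinearMap.range (Finsupp.linearCombination K v).dualMap := by
    rw [LinearMap.range_dualMap_eq_dualAnnihilator_ker, Submodule.mem_dualAnnihilator]
    intro l hl
    -- A relation involves finitely many levels, so a common solution up to the highest of them
    -- verifies it.
    obtain ⟨f, hf⟩ := hx (l.support.sup Sigma.fst)
    rw [← hcomb f l fun j hj => hf _ (Finset.le_sup (f := Sigma.fst) hj), LinearMap.mem_ker.1 hl,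
      map_zero]
  obtain ⟨F, hF⟩ := hb
  let f : MvPowerSeries σ K := fun s => F (Finsupp.single s 1)
  have hFf : F = Finsupp.linearCombination K fun s => MvPowerSeries.coeff s f := by
    ext s
    simp only [LinearMap.comp_apply, Finsupp.lsingle_apply, Finsupp.linearCombination_single,
      one_smul]
    rfl
  refine ⟨f, fun k => ?_⟩
  -- Linear functionals separate the points of `C k`, so the scalar conditions recover the original
  -- one.
  rw [← sub_eq_zero, ← Module.forall_dual_apply_eq_zero_iff K]
  intro l
  have h := LinearMap.congr_fun hF (Finsupp.single ⟨k, l⟩ 1)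
  rw [LinearMap.dualMap_apply, hFf, Finsupp.linearCombination_single, one_smul, hv] at h
  rw [map_sub, h]
  simp [b]

end PowerSeries
open Extension
universe u v w x

/-! ### Derivations and the extension by all Harrison classes -/

section Harrison

variable {K : Type u} [Field K] {A : Type w} [CommRing A] [Algebra K A] {ε : A →ₐ[K] K}

/-- A derivation into the residue field detects an element that is not decomposable. -/
theorem exists_derivation_apply_ne_zero (ε : A →ₐ[K] K) {x : A} (hx : ε x = 0)
    (hx' : x ∉ RingHom.ker ε ^ 2) :
    ∃ L : A →ₗ[K] K, L x ≠ 0 ∧ ∀ u v, L (u * v) = ε u * L v + ε v * L u := by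
  obtain ⟨l, hlx, hl⟩ := Submodule.exists_le_ker_of_notMem (K := K)
    (p := (RingHom.ker ε ^ 2).restrictScalars K) (v := x)
    (by rwa [Submodule.restrictScalars_mem])
  -- The correction by `l 1` makes `L` vanish on `1` without changing it on the augmentation ideal.
  -- The Leibniz rule is then the vanishing of `l` on a product of two augmentation parts.
  let L : A →ₗ[K] K := l - (LinearMap.toSpanSingleton K K (l 1)).comp ε.toLinearMap
  have hL (u) : L u = l u - ε u * l 1 := by simp [L]
  refine ⟨L, by rwa [hL, hx, zero_mul, sub_zero], fun u v => ?_⟩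
  have hmem (u) : u - ε u • 1 ∈ RingHom.ker ε := by
    rw [RingHom.mem_ker, map_sub, map_smul, map_one, smul_eq_mul, mul_one, sub_self]
  have h : l ((u - ε u • 1) * (v - ε v • 1)) = 0 := by
    refine LinearMap.mem_ker.1 (hl ?_)
    rw [Submodule.restrictScalars_mem, pow_two]
    exact Ideal.mul_mem_mul (hmem u) (hmem v)
  simp only [sub_mul, mul_sub, smul_mul_assoc, mul_smul_comm, one_mul, mul_one, map_sub,
    map_smul, smul_eq_mul] at h
  rw [hL, hL, hL, map_mul ε]
  linear_combination h

/-- The cocycle measures the failure of the linear splitting `q` to be multiplicative: `q a * q b =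
q (a * b) + i (f a b)`. Applying a derivation `L` shows that `L ∘ q` is a primitive of the cocycle
`f` pushed forward along `L ∘ i`. -/
theorem harrisonCoboundary_derivation {M : Type x} [AddCommGroup M] [Module K M]
    (f : harrisonCocycles ε M) (L : Extension f →ₗ[K] K)
    (hL : ∀ u v, L (u * v) = aug f u * L v + aug f v * L u) (a b : A) :
    harrisonCoboundary ε K (L ∘ₗ inlL f) a b = L (inrL f (f.1 a b)) := by
  have haug (u) : aug f u = ε (fstL _ u) := rfl
  have hmul : inlL f a * inlL f b = inlL f (a * b) + inrL f (f.1 a b) := by ext <;> simp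
  have h := hL (inlL f a) (inlL f b)
  rw [hmul, map_add, haug, haug, fst_inl, fst_inl] at h
  simp only [harrisonCoboundary, LinearMap.coe_mk, AddHom.coe_mk, LinearMap.mk₂_apply,
    LinearMap.comp_apply, smul_eq_mul]
  linear_combination -h

/-- An extension by a cocycle that represents all cohomology classes is as far from being split as
possible: its kernel consists of decomposable elements. -/
theorem ker_proj_universalCocycle_le [FiniteDimensional K A]
    (μ : HarrisonH2 ε K →ₗ[K] harrisonCocycles ε K) (hμ : ∀ h, Submodule.Quotient.mk (μ h) = h) :
    RingHom.ker (proj (universalCocycle μ)) ≤ RingHom.ker (aug (universalCocycle μ)) ^ 2 := by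
  intro x hx
  have hx0 : fstL _ x = 0 := hx
  have haug (u) : aug (universalCocycle μ) u = ε (fstL _ u) := rfl
  by_contra hxJ
  obtain ⟨L, hLx, hderiv⟩ := exists_derivation_apply_ne_zero (aug (universalCocycle μ))
    (by rw [haug, hx0, map_zero]) hxJ
  -- As `A` is finite-dimensional, so is its Harrison cohomology; by reflexivity the restriction of
  -- `L` to the kernel is evaluation at a class `h`. Pushing the universal cocycle along this
  -- evaluation gives the representative `μ h`.
  obtain ⟨h, hh⟩ := (Module.evalEquiv K (HarrisonH2 ε K)).surjective
    (L ∘ₗ inrL (universalCocycle μ))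
  have hLinr (m) : L (inrL (universalCocycle μ) m) = m h := by
    rw [← LinearMap.comp_apply, ← hh]; rfl
  have hcob : harrisonCoboundary ε K (L ∘ₗ inlL (universalCocycle μ)) = (μ h).1 := by
    refine LinearMap.ext fun a => LinearMap.ext fun b => ?_
    rw [harrisonCoboundary_derivation _ L hderiv, hLinr]
    rfl
  -- The representative of `h` is now a coboundary, so `L` vanishes on the whole kernel, contrary to
  -- `L x ≠ 0`.
  have hzero : h = 0 := by
    rw [← hμ h, Submodule.Quotient.mk_eq_zero]
    exact ⟨_, hcob⟩
  have hxinr : x = inrL (universalCocycle μ) (sndL _ x) := by ext <;> simp [hx0]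
  exact hLx (by rw [hxinr, hLinr, hzero, map_zero])

theorem ker_proj_mul_ker_aug {M : Type x} [AddCommGroup M] [Module K M] (f : harrisonCocycles ε M)
    {u v : Extension f} (hu : proj f u = 0) (hv : aug f v = 0) : u * v = 0 := by
  have hu' : fstL f u = 0 := hu
  have hv' : ε (fstL f v) = 0 := hv
  ext <;> simp [hu', hv']

end Harrison

/-! ### One step of the construction -/

section Step

variable {K : Type u} [Field K] {D : Type v} [AddCommGroup D] [Module K D] {𝒟 : Dialgebra K D}
  {A : Type w} [CommRing A] [Algebra K A] {ε : A →ₐ[K] K} {η : Deformation 𝒟 ε}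
  {B : Type x} [CommRing B] [Algebra K B] {p : B →ₐ[K] A}

/-- All that the later arguments need from the next base is that it is a quotient, over `A`, of the
extension by the universal cocycle. -/
theorem IsNextStep.exists_algHom (h : IsNextStep η p) :
    ∃ μ : HarrisonH2 ε K →ₗ[K] harrisonCocycles ε K, (∀ h, Submodule.Quotient.mk (μ h) = h) ∧
      ∃ q : Extension (universalCocycle μ) →ₐ[K] B, Function.Surjective q ∧
        p.comp q = proj (universalCocycle μ) := by
  obtain ⟨μ, hμ, e, he⟩ := h
  refine ⟨μ, hμ, e.symm.toAlgHom.comp (Ideal.Quotient.mkₐ K (nextIdeal η μ)),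
    e.symm.surjective.comp Ideal.Quotient.mk_surjective, AlgHom.ext fun u => ?_⟩
  have := he (e.symm (Ideal.Quotient.mkₐ K (nextIdeal η μ) u))
  rw [e.apply_symm_apply] at this
  exact this.symm

theorem IsNextStep.surjective (h : IsNextStep η p) : Function.Surjective p := by
  obtain ⟨μ, -, q, -, hpq⟩ := h.exists_algHom
  intro a
  exact ⟨q (inlL _ a), by rw [← AlgHom.comp_apply, hpq]; simp⟩

theorem IsNextStep.finiteDimensional [FiniteDimensional K A] (h : IsNextStep η p) :
    FiniteDimensional K B := by
  obtain ⟨μ, -, q, hq, -⟩ := h.exists_algHom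
  have : FiniteDimensional K (Extension (universalCocycle μ)) :=
    inferInstanceAs (FiniteDimensional K (A × Module.Dual K (HarrisonH2 ε K)))
  exact FiniteDimensional.of_surjective q.toLinearMap hq

/-- In the extension `A` acts on the kernel through `ε`, so the augmentation ideal annihilates the
kernel; since `p ∘ q` is the projection, lifts along `q` reduce the claim to that case. -/
theorem IsNextStep.mul_eq_zero (h : IsNextStep η p) {x y : B} (hx : p x = 0) (hy : ε (p y) = 0) :
    x * y = 0 := by
  obtain ⟨μ, -, q, hq, hpq⟩ := h.exists_algHom
  obtain ⟨u, rfl⟩ := hq x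
  obtain ⟨v, rfl⟩ := hq y
  rw [← AlgHom.comp_apply p, hpq] at hx hy
  rw [← map_mul, ker_proj_mul_ker_aug _ hx hy, map_zero]

/-- Decomposability of the kernel survives the quotient: a lift of an element of `ker p` lies in the
kernel of the extension, and `q` preserves augmentations. -/
theorem IsNextStep.ker_le [FiniteDimensional K A] (h : IsNextStep η p) :
    RingHom.ker p ≤ RingHom.ker (ε.comp p) ^ 2 := by
  obtain ⟨μ, hμ, q, hq, hpq⟩ := h.exists_algHom
  intro x hx
  obtain ⟨u, rfl⟩ := hq x
  rw [RingHom.mem_ker, ← AlgHom.comp_apply, hpq] at hx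
  have hu := Ideal.mem_map_of_mem q (ker_proj_universalCocycle_le μ hμ hx)
  rw [Ideal.map_pow] at hu
  refine Ideal.pow_right_mono (Ideal.map_le_iff_le_comap.2 fun v hv => ?_) 2 hu
  rw [Ideal.mem_comap, RingHom.mem_ker, AlgHom.comp_apply, ← AlgHom.comp_apply p, hpq]
  exact hv

/-- Lifts of algebra generators generate the next base. -/
theorem IsNextStep.subalgebra_eq_top [FiniteDimensional K A] (h : IsNextStep η p)
    {S : Subalgebra K B} (hS : S.map p = ⊤) : S = ⊤ := by
  have hdec (x : B) : ∃ s ∈ S, p (x - s) = 0 := by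
    obtain ⟨s, hs, hsx⟩ : p x ∈ S.map p := hS ▸ Algebra.mem_top
    exact ⟨s, hs, by rw [map_sub, sub_eq_zero]; exact hsx.symm⟩
  -- Replacing the factors of a product in the augmentation ideal by elements of `S` congruent
  -- modulo `ker p` leaves the product unchanged, because `ker p` annihilates that ideal. Hence `S`
  -- contains its square, and with it `ker p`.
  have hsq : ∀ z ∈ RingHom.ker (ε.comp p) ^ 2, z ∈ S := by
    intro z hz
    rw [pow_two] at hz
    refine Submodule.mul_induction_on hz (fun x hx y hy => ?_) fun x y => S.add_mem
    obtain ⟨s, hs, hxs⟩ := hdec x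
    obtain ⟨t, ht, hyt⟩ := hdec y
    have hs0 : ε (p s) = 0 := by
      rw [map_sub, sub_eq_zero] at hxs
      rw [← hxs]
      exact hx
    have h1 := h.mul_eq_zero hxs (y := y) hy
    have h2 := h.mul_eq_zero hyt (y := s) hs0
    have : x * y = s * t := by linear_combination h1 + h2
    rw [this]
    exact S.mul_mem hs ht
  rw [eq_top_iff]
  intro x _
  obtain ⟨s, hs, hxs⟩ := hdec x
  simpa using S.add_mem (hsq _ (h.ker_le hxs)) hs

end Step

/-! ### The algebras of the tower -/

namespace Tower

variable {K : Type u} [Field K] {D : Type v} [AddCommGroup D] [Module K D] {𝒟 : Dialgebra K D}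
  (T : Tower.{u, v, w} 𝒟)

theorem ε_p_apply (k : ℕ) (x : T.C (k + 1)) : T.ε k (T.p k x) = T.ε (k + 1) x := by
  rw [← T.ε_p k, AlgHom.comp_apply]

theorem p_surjective : ∀ k, Function.Surjective (T.p k)
  | 0 => fun x => ⟨algebraMap K _ (T.ε 0 x), T.zero.1 (by simp)⟩
  | k + 1 => (T.succ (k + 1) (by omega)).surjective

theorem finiteDimensional [FiniteDimensional K (HY 𝒟 2)] (k : ℕ) :
    FiniteDimensional K (T.C (k + 1)) := by
  induction k with
  | zero =>
    obtain ⟨e, -⟩ := T.one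
    have : FiniteDimensional K (TrivSqZeroExt K (Module.Dual K (HY 𝒟 2))) :=
      inferInstanceAs (FiniteDimensional K (K × Module.Dual K (HY 𝒟 2)))
    exact e.toLinearEquiv.symm.finiteDimensional
  | succ k ih => exact (T.succ (k + 1) (by omega)).finiteDimensional

/-- `e` is not assumed to respect augmentations, but an augmentation is forced: elements of square
zero must go to zero in the field `K`. -/
theorem ε_one_eq (e : T.C 1 ≃ₐ[K] TrivSqZeroExt K (Module.Dual K (HY 𝒟 2))) (x : T.C 1) :
    T.ε 1 x = (e x).fst := by
  obtain ⟨y, rfl⟩ := e.symm.surjective x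
  rw [e.apply_symm_apply]
  have hinr (m) : T.ε 1 (e.symm (TrivSqZeroExt.inr m)) = 0 := by
    have : T.ε 1 (e.symm (TrivSqZeroExt.inr m)) ^ 2 = 0 := by
      rw [← map_pow, ← map_pow, pow_two, TrivSqZeroExt.inr_mul_inr, map_zero, map_zero]
    exact pow_eq_zero_iff two_ne_zero |>.1 this
  have hinl (r : K) : T.ε 1 (e.symm (TrivSqZeroExt.inl r)) = r := by
    rw [← TrivSqZeroExt.algebraMap_eq_inl, AlgEquiv.commutes, AlgHom.commutes]
    rfl
  conv_lhs => rw [← TrivSqZeroExt.inl_fst_add_inr_snd_eq y]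
  rw [map_add, map_add, hinr, hinl, add_zero]

/-- Each extension costs one more power: if `x ^ N` dies in `C (k + 1)`, it lies in the kernel of
the projection, which `x` annihilates. -/
theorem isNilpotent : ∀ (k : ℕ) (x : T.C k), T.ε k x = 0 → IsNilpotent x
  | 0, x, hx => ⟨1, by rw [pow_one]; exact T.zero.1 (by rw [hx, map_zero])⟩
  | 1, x, hx => by
    obtain ⟨e, -⟩ := T.one
    rw [T.ε_one_eq e] at hx
    refine ⟨2, e.injective ?_⟩
    rw [map_pow, map_zero, ← TrivSqZeroExt.inl_fst_add_inr_snd_eq (e x), hx, TrivSqZeroExt.inl_zero,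
      zero_add, pow_two, TrivSqZeroExt.inr_mul_inr]
  | k + 2, x, hx => by
    rw [← T.ε_p_apply] at hx
    obtain ⟨N, hN⟩ := isNilpotent (k + 1) (T.p (k + 1) x) hx
    rw [← map_pow] at hN
    exact ⟨N + 1, by rw [pow_succ]; exact (T.succ (k + 1) (by omega)).mul_eq_zero hN hx⟩

/-- Lifts are chosen successively along the surjective projections, starting from level one; the
component at level zero is the image of `x`. -/
theorem exists_mem_limit (x : T.C 1) : ∃ c ∈ T.limit, c 1 = x := by
  let c' : ∀ k, T.C (k + 1) := Nat.rec x fun k y => (T.p_surjective (k + 1) y).choose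
  let c : ∀ k, T.C k := fun k => match k with
    | 0 => T.p 0 x
    | k + 1 => c' k
  refine ⟨c, fun k => ?_, rfl⟩
  cases k with
  | zero => rfl
  | succ k => exact (T.p_surjective (k + 1) (c' k)).choose_spec

theorem mul_eq_zero_of_ε_one {x y : T.C 1} (hx : T.ε 1 x = 0) (hy : T.ε 1 y = 0) : x * y = 0 := by
  obtain ⟨e, -⟩ := T.one
  rw [T.ε_one_eq e] at hx hy
  refine e.injective ?_
  rw [map_mul, map_zero, ← TrivSqZeroExt.inl_fst_add_inr_snd_eq (e x), hx,
    ← TrivSqZeroExt.inl_fst_add_inr_snd_eq (e y), hy, TrivSqZeroExt.inl_zero,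
    zero_add, zero_add, TrivSqZeroExt.inr_mul_inr]

theorem ε_apply_of_mem_limit {c : ∀ k, T.C k} (hc : c ∈ T.limit) (k : ℕ) :
    T.ε k (c k) = T.ε 1 (c 1) := by
  have h0 (k : ℕ) : T.ε k (c k) = T.ε 0 (c 0) := by
    induction k with
    | zero => rfl
    | succ k ih => rw [← ε_p_apply, hc k, ih]
  rw [h0 k, h0 1]

/-! ### Maps from the power series ring to the tower and to its limit -/

/-- A compatible family of maps of algebras to the `C k` consists of surjections if the map to `C 1`
is surjective. -/
theorem algHom_surjective [FiniteDimensional K (HY 𝒟 2)] {R : Type*} [CommRing R] [Algebra K R]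
    (φ : ∀ k, R →ₐ[K] T.C k) (hφ : ∀ k, (T.p k).comp (φ (k + 1)) = φ k)
    (h1 : Function.Surjective (φ 1)) : ∀ k, Function.Surjective (φ k)
  | 0 => by
    rw [← hφ 0]
    exact (T.p_surjective 0).comp h1
  | 1 => h1
  | k + 2 => by
    have ih := algHom_surjective φ hφ h1 (k + 1)
    have := T.finiteDimensional k
    rw [← AlgHom.range_eq_top]
    refine (T.succ (k + 1) (by omega)).subalgebra_eq_top ?_
    rw [← AlgHom.range_comp, hφ, AlgHom.range_eq_top]
    exact ih

/-- A map of algebras from a formal power series ring that sends the variables to a basis of the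
maximal ideal of `C 1` is injective up to the square of the maximal ideal. -/
theorem ker_algHom_one_le {σ : Type*} [Finite σ] (φ : MvPowerSeries σ K →ₐ[K] T.C 1)
    (e : T.C 1 ≃ₐ[K] TrivSqZeroExt K (Module.Dual K (HY 𝒟 2)))
    (b : Module.Basis σ K (Module.Dual K (HY 𝒟 2)))
    (hφ : ∀ i, e (φ (MvPowerSeries.X i)) = TrivSqZeroExt.inr (b i)) :
    RingHom.ker φ ≤ IsLocalRing.maximalIdeal (MvPowerSeries σ K) ^ 2 := by
  classical
  cases nonempty_fintype σ
  -- The kernel of a surjection to a field is maximal, so locality identifies it with `m`.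
  -- Consequently `φ` sends `m` into the square-zero augmentation ideal of `C 1` and kills `m ^ 2`.
  have hm : IsLocalRing.maximalIdeal (MvPowerSeries σ K) = RingHom.ker ((T.ε 1).comp φ) := by
    have := RingHom.ker_isMaximal_of_surjective ((T.ε 1).comp φ) fun r => ⟨algebraMap K _ r, by simp⟩
    exact (IsLocalRing.eq_maximalIdeal this).symm
  have hm2 (g) (hg : g ∈ IsLocalRing.maximalIdeal (MvPowerSeries σ K) ^ 2) : φ g = 0 := by
    rw [pow_two, hm] at hg
    refine Submodule.mul_induction_on hg (fun x hx y hy => ?_) fun x y hx hy => ?_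
    · rw [map_mul]
      exact T.mul_eq_zero_of_ε_one hx hy
    · rw [map_add, hx, hy, add_zero]
  intro f hf
  rw [RingHom.mem_ker] at hf
  -- Modulo `m ^ 2` only the affine part of `f` remains. Its image under `e` displays the constant
  -- term as first component and the linear coefficients as coordinates in the basis `b`.
  have hg : f - (MvPowerSeries.coeff 0 f • 1 +
      ∑ i, MvPowerSeries.coeff (Finsupp.single i 1) f • MvPowerSeries.X i) ∈
      IsLocalRing.maximalIdeal (MvPowerSeries σ K) ^ 2 := by
    refine mem_maximalIdeal_sq _ ?_ fun j => ?_
    · simp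
    · simp [MvPowerSeries.coeff_X, MvPowerSeries.coeff_one, Finsupp.single_left_inj]
  have h := hm2 _ hg
  rw [map_sub, hf, zero_sub, neg_eq_zero] at h
  replace h := congrArg e h
  simp only [map_add, map_sum, map_smul, map_one, hφ, map_zero] at h
  have hfst := congrArg TrivSqZeroExt.fst h
  have hsnd := congrArg (TrivSqZeroExt.sndHom K (Module.Dual K (HY 𝒟 2))) h
  simp only [map_add, map_sum, map_smul, TrivSqZeroExt.sndHom_apply, TrivSqZeroExt.snd_one,
    TrivSqZeroExt.snd_inr, smul_zero, zero_add, TrivSqZeroExt.snd_zero] at hsnd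
  refine mem_maximalIdeal_sq f ?_ (Fintype.linearIndependent_iff.1 b.linearIndependent _ hsnd)
  simpa [TrivSqZeroExt.fst_sum] using hfst

theorem algHom_one_surjective {σ : Type*} (φ : MvPowerSeries σ K →ₐ[K] T.C 1)
    (e : T.C 1 ≃ₐ[K] TrivSqZeroExt K (Module.Dual K (HY 𝒟 2)))
    (b : Module.Basis σ K (Module.Dual K (HY 𝒟 2)))
    (hφ : ∀ i, e (φ (MvPowerSeries.X i)) = TrivSqZeroExt.inr (b i)) :
    Function.Surjective φ := by
  have hinr (m : Module.Dual K (HY 𝒟 2)) : ∃ f, e (φ f) = TrivSqZeroExt.inr m := by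
    induction b.mem_span m using Submodule.span_induction with
    | mem x hx =>
      obtain ⟨i, rfl⟩ := hx
      exact ⟨_, hφ i⟩
    | zero => exact ⟨0, by simp⟩
    | add x y _ _ hx hy =>
      obtain ⟨f, hf⟩ := hx
      obtain ⟨g, hg⟩ := hy
      exact ⟨f + g, by rw [map_add, map_add, hf, hg, TrivSqZeroExt.inr_add]⟩
    | smul r x _ hx =>
      obtain ⟨f, hf⟩ := hx
      exact ⟨r • f, by rw [map_smul, map_smul, hf, TrivSqZeroExt.inr_smul]⟩
  intro x
  obtain ⟨f, hf⟩ := hinr (e x).snd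
  refine ⟨algebraMap K _ (e x).fst + f, e.injective ?_⟩
  rw [map_add, map_add, hf, AlgHom.commutes, AlgEquiv.commutes, TrivSqZeroExt.algebraMap_eq_inl,
    TrivSqZeroExt.inl_fst_add_inr_snd_eq]

theorem exists_limit_algEquiv [FiniteDimensional K (HY 𝒟 2)] {σ : Type*} [Finite σ]
    (b : Module.Basis σ K (Module.Dual K (HY 𝒟 2))) :
    ∃ I : Ideal (MvPowerSeries σ K), I ≤ IsLocalRing.maximalIdeal (MvPowerSeries σ K) ^ 2 ∧
      Nonempty (T.limit ≃ₐ[K] (MvPowerSeries σ K ⧸ I)) := by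
  obtain ⟨e, -⟩ := T.one
  -- The variables are sent to compatible lifts of the basis; choosing the lifts in the limit makes
  -- the evaluations at different levels agree under the projections.
  choose c hc hc1 using fun i => T.exists_mem_limit (e.symm (TrivSqZeroExt.inr (b i)))
  have hnil (k : ℕ) (i : σ) : IsNilpotent (c i k) := by
    refine T.isNilpotent k _ ?_
    rw [T.ε_apply_of_mem_limit (hc i), hc1, T.ε_one_eq e, e.apply_symm_apply,
      TrivSqZeroExt.fst_inr]
  choose φ hφ hφX using fun k => exists_algHom_apply_eq (K := K) (hnil k)
  have hcompat (k : ℕ) (f) : T.p k (φ (k + 1) f) = φ k f := by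
    rw [hφ, hφ, map_finsum (T.p k) ((finite_support_prod_pow (hnil (k + 1))).subset
      fun s hs h => hs (by simp [h]))]
    refine finsum_congr fun s => ?_
    rw [map_smul, Finsupp.prod, Finsupp.prod, map_prod]
    simp only [map_pow, hc _ k]
  have he (i) : e (φ 1 (MvPowerSeries.X i)) = TrivSqZeroExt.inr (b i) := by
    rw [hφX, hc1, e.apply_symm_apply]
  have hsurj := T.algHom_surjective φ (fun k => AlgHom.ext (hcompat k))
    (T.algHom_one_surjective (φ 1) e b he)
  let Φ : MvPowerSeries σ K →ₐ[K] T.limit :=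
    (AlgHom.pi φ).codRestrict T.limit fun f k => hcompat k f
  have hΦ (f k) : (Φ f).1 k = φ k f := rfl
  -- By linear compactness it suffices to match finitely many components, and a series matching `x`
  -- at level `N` matches it at all lower levels by compatibility.
  have hΦsurj : Function.Surjective Φ := by
    intro x
    obtain ⟨f, hf⟩ := exists_forall_algHom_apply_eq (fun k i => c i k) hnil φ hφ x.1 fun N => by
      obtain ⟨f, hf⟩ := hsurj N (x.1 N)
      refine ⟨f, fun k hk => ?_⟩
      induction hk using Nat.decreasingInduction with
      | self => exact hf
      | of_succ k hk ih => rw [← hcompat, ih, x.2 k]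
    exact ⟨f, Subtype.ext (funext hf)⟩
  refine ⟨RingHom.ker Φ, fun f hf => T.ker_algHom_one_le (φ 1) e b he ?_,
    ⟨(Ideal.quotientKerAlgEquivOfSurjective hΦsurj).symm⟩⟩
  rw [RingHom.mem_ker] at hf ⊢
  rw [← hΦ, hf]
  rfl

end Tower
end DialgebraDeformation

theorem mainTheorem10 {K : Type*} [Field K] [CharZero K] {D : Type*} [AddCommGroup D] [Module K D]
    (𝒟 : DialgebraDeformation.Dialgebra K D)
    [FiniteDimensional K (DialgebraDeformation.HY 𝒟 2)]
    (T : DialgebraDeformation.Tower 𝒟) :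
    ∃ I : Ideal (MvPowerSeries (Fin (Module.finrank K (DialgebraDeformation.HY 𝒟 2))) K),
      I ≤ IsLocalRing.maximalIdeal
        (MvPowerSeries (Fin (Module.finrank K (DialgebraDeformation.HY 𝒟 2))) K) ^ 2 ∧
      Nonempty (T.limit ≃ₐ[K]
        (MvPowerSeries (Fin (Module.finrank K (DialgebraDeformation.HY 𝒟 2))) K ⧸ I)) :=
  -- The variables correspond to the coordinate functionals of a basis of `HY 𝒟 2`.
  T.exists_limit_algEquiv (Module.finBasis K (DialgebraDeformation.HY 𝒟 2)).dualBasis
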